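/- Let \(\mathbb F_q\) be a finite field of characteristic \(p\), with standard additive character \(\psi(z)=\exp(2\pi\sqrt{-1}\,\mathrm{Tr}_{\mathbb F_q/\mathbb F_p}(z)/p)\), and let \(\epsilon:\mathbb F_q^n\to(\mathbb C^*)^n\) apply \(\psi\) componentwise. For a linear code \(\mathcal C\subseteq\mathbb F_q^n\), its dual distance is the least Hamming weight of a nonzero word of the dual code \(\mathcal C^\perp\) (and \(\infty\) if \(\mathcal C^\perp=0\)). Let \(\mathcal C^a,\mathcal C^b\subseteq\mathbb F_q^n\) be linear codes whose dual distances are both at least \(5\), and let \(N_a,N_b\) be positive integers. Choose independently and uniformly at random two maps \(s^{(a)}:\{1,\dots,N_a\}\to\epsilon(\mathcal C^a)\) and \(s^{(b)}:\{1,\dots,N_b\}\to\epsilon(\mathcal C^b)\), and let \(A\) (of size \(N_a\times n\)) and \(B\) (of size \(N_b\times n\)) be the matrices with rows \(s^{(a)}(1),\dots,s^{(a)}(N_a)\) and \(s^{(b)}(1),\dots,s^{(b)}(N_b)\). Let \(\mathcal G=MM^*\) be the Gram matrix of \(M=\frac1{\sqrt{N_aN_b}}AB^*\), let \(\lambda_1,\dots,\lambda_{N_a}\)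 be its eigenvalues, and let \(A_l=\frac1{N_a}\sum_{i=1}^{N_a}\lambda_i^l\) be the \(l\)-th moment of its spectral measure. Put \(y_a=n/N_a\), \(y_b=n/N_b\), \(Y_a=\max\{1,y_a\}\), \(Y_b=\max\{1,y_b\}\), and for \(j\ge1\) \[m^{(j)}(y)=\sum_{i=0}^{j-1}\frac{y^i}{i+1}\binom{j}{i}\binom{j-1}{i},\] the \(j\)-th moment of the Marchenko–Pastur distribution with parameter \(y\). Then for every integer \(l\) with \(2\le l<\min\{\sqrt{N_a},\sqrt{N_b}\}\), \[\mathbb E(A_l)=\sum_{i=1}^{l}y_a^{\,l-i+1}\sum_{\substack{k_1,\dots,k_i\ge0\\ k_1+k_2+\cdots+k_i=l-i+1\\ k_1+2k_2+\cdots+ik_i=l}}\frac{l!}{i!}\prod_{j=1}^{i}\frac{m^{(j)}(y_b)^{k_j}}{k_j!}+E_l,\qquad |E_l|\le\frac{l^{6l}\,Y_a(Y_aY_b)^l}{\min\{N_a,N_b\}}.\] -/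

import Mathlib

open scoped Matrix BigOperators

noncomputable section

/-- The standard additive character `ψ(z) = exp(2πi Tr(z) / p)` of a finite field `F` of
characteristic `p`, where `Tr` is the trace from `F` to its prime field. -/
def stdChar (p : ℕ) [Fact p.Prime] {F : Type*} [Field F] [Algebra (ZMod p) F] (z : F) : ℂ :=
  Complex.exp (2 * Real.pi * Complex.I * ((Algebra.trace (ZMod p) F z).val : ℂ) / (p : ℂ))

/-- The dual of a linear code `C` of length `n`, for the form `∑ t, c t * v t`. -/
def dualCode {F : Type*} [Field F] {n : ℕ} (C : Submodule F (Fin n → F)) :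
    Submodule F (Fin n → F) where
  carrier := {v | ∀ c ∈ C, c ⬝ᵥ v = 0}
  add_mem' := fun {u v} hu hv c hc => by rw [dotProduct_add, hu c hc, hv c hc, add_zero]
  zero_mem' := fun c _ => dotProduct_zero c
  smul_mem' := fun a v hv c hc => by rw [dotProduct_smul, hv c hc, smul_zero]

open Classical in
/-- The minimum Hamming distance of a linear code: the least Hamming weight of a nonzero
codeword (infinite when the code is zero). -/
def minDistance {F : Type*} [Field F] {n : ℕ} (C : Submodule F (Fin n → F)) : ℕ∞ :=
  ⨅ c ∈ {c : Fin n → F | c ∈ C ∧ c ≠ 0}, (hammingNorm c : ℕ∞)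

/-- The dual distance of a linear code: the minimum distance of its dual. -/
def dualDistance {F : Type*} [Field F] {n : ℕ} (C : Submodule F (Fin n → F)) : ℕ∞ :=
  minDistance (dualCode C)

open Classical in
/-- The set `ε(C)` of vectors in `ℂⁿ` obtained by applying the standard additive character
componentwise to the codewords of `C`. -/
def signalSet (p : ℕ) [Fact p.Prime] {F : Type*} [Field F] [Fintype F] [Algebra (ZMod p) F]
    {n : ℕ} (C : Submodule F (Fin n → F)) : Finset (Fin n → ℂ) :=
  (Finset.univ.filter fun c : Fin n → F => c ∈ C).image fun c t => stdChar p (c t)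

/-- The `N × n` matrix whose rows are the values of `s`. -/
def rowMatrix {n N : ℕ} {D : Finset (Fin n → ℂ)} (s : Fin N → D) : Matrix (Fin N) (Fin n) ℂ :=
  Matrix.of fun i t => (s i : Fin n → ℂ) t

/-- The Gram matrix `M Mᴴ`. -/
def gram {m n : ℕ} (M : Matrix (Fin m) (Fin n) ℂ) : Matrix (Fin m) (Fin m) ℂ := M * Mᴴ

theorem gram_isHermitian {m n : ℕ} (M : Matrix (Fin m) (Fin n) ℂ) : (gram M).IsHermitian :=
  Matrix.isHermitian_mul_conjTranspose_self M

/-- The `l`-th moment `(1/N) ∑ i, λᵢ ^ l` of the spectral measure `(1/N) ∑ i, δ_{λᵢ}` of a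
Hermitian `N × N` matrix with eigenvalues `λ₁, …, λ_N`. -/
def spectralMoment {N : ℕ} {G : Matrix (Fin N) (Fin N) ℂ} (hG : G.IsHermitian) (l : ℕ) : ℝ :=
  (1 / (N : ℝ)) * ∑ i : Fin N, hG.eigenvalues i ^ l

/-- The matrix `(1 / √(Na Nb)) A Bᴴ`. -/
def normalizedProduct {n Na Nb : ℕ} (A : Matrix (Fin Na) (Fin n) ℂ)
    (B : Matrix (Fin Nb) (Fin n) ℂ) : Matrix (Fin Na) (Fin Nb) ℂ :=
  ((1 / Real.sqrt ((Na : ℝ) * (Nb : ℝ)) : ℝ) : ℂ) • (A * Bᴴ)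

/-- The expected `l`-th moment of the spectral measure of the Gram matrix of
`(1 / √(Na Nb)) A Bᴴ`, where the rows of `A` (resp. `B`) are given by a uniformly random map from
the `Na` (resp. `Nb`) row indices to `ε(Ca)` (resp. `ε(Cb)`), the two maps being independent. -/
def expectedMoment (p : ℕ) [Fact p.Prime] {F : Type*} [Field F] [Fintype F] [Algebra (ZMod p) F]
    {n : ℕ} (Ca Cb : Submodule F (Fin n → F)) (Na Nb l : ℕ) : ℝ :=
  (∑ s : (Fin Na → signalSet p Ca) × (Fin Nb → signalSet p Cb),
      spectralMoment
        (gram_isHermitian (normalizedProduct (rowMatrix s.1) (rowMatrix s.2))) l) /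
    (Fintype.card ((Fin Na → signalSet p Ca) × (Fin Nb → signalSet p Cb)) : ℝ)

/-- The `l`-th moment of the Marchenko–Pastur distribution with parameter `y`, for `l ≥ 1`. -/
def mpMoment (l : ℕ) (y : ℝ) : ℝ :=
  ∑ i ∈ Finset.range l, y ^ i / ((i : ℝ) + 1) * (l.choose i : ℝ) * ((l - 1).choose i : ℝ)

/-- The main term. For each `i`, the inner sum runs over the `i`-tuples `(k₁, …, kᵢ)` of
nonnegative integers with `k₁ + ⋯ + kᵢ = l - i + 1` and `k₁ + 2 k₂ + ⋯ + i kᵢ = l`; the entry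
`k j` for `j : Fin i` is `k_{j+1}`. -/
def mainTerm (l : ℕ) (ya yb : ℝ) : ℝ :=
  ∑ i ∈ Finset.Icc 1 l, ya ^ (l - i + 1) *
    ∑ k ∈ (Finset.piAntidiag (Finset.univ : Finset (Fin i)) (l - i + 1)).filter
        (fun k : Fin i → ℕ => ∑ j : Fin i, ((j : ℕ) + 1) * k j = l),
      ((l.factorial : ℝ) / (i.factorial : ℝ)) *
        ∏ j : Fin i, mpMoment ((j : ℕ) + 1) yb ^ k j / ((k j).factorial : ℝ)

end

/-! By cyclicity of the trace, the moment is a multiple of the trace of (A*A B*B)^l. Both A*A and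
B*B are sums, over rows, of rank-one matrices with entries ψ(c_s - c_t). Hence the expectation is a
sum of averaged traces `wordTrace` over words of length 2l in the row labels, alternating between A
and B. Averaging a row over its code turns its character into the indicator of the dual code, and
dual distance at least 5 makes every relation among four coordinate vectors trivial
(`isFourWise_codeChar`).

Two reductions act on a word: a letter that occurs once averages to the identity and can be deleted,
and a pair aa can be merged into a at the price of a factor n. Words accepted by a stack automaton
reduce to nothing, and their trace is exactly n^(1+L-d), with L the length and d the number of
distinct letters (`IsFourWise.wordTrace_of_accepts`). Any other word reduces to a nonempty word with
no equal neighbours and no single letters. A count of closed paths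
(`IsFourWise.card_balancedPaths_le`) bounds its trace by 3 n^(L-d), so a factor n is lost.

In the sum over accepted words a push has about N choices, and a match has weight n = N y. The total
is therefore (N_a N_b)^l times `stackSum`, up to a relative error of order l^2 / min(N_a, N_b),
because pushed letters must be new. The first-return decomposition of the stack gives the equation E
- 1 = X (1 + y_a (E - 1)) E (1 + y_b (E - 1)) for the generating series. Lagrange inversion, applied
to this series and to powers of the Marchenko–Pastur moment series, identifies its coefficient with
the main term (`mainTerm_eq_coeff`). -/

set_option linter.unusedSectionVars false

/-! ### Lagrange inversion for formal power series. -/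

section LagrangeInversion

open PowerSeries in
theorem coeff_mul_aeval_eq_sum {G : PowerSeries ℝ} (φ : Polynomial ℝ) (k m N : ℕ)
    (hN : φ.natDegree < N) :
    coeff m (G ^ k * Polynomial.aeval G φ) =
      ∑ j ∈ Finset.range N, φ.coeff j * coeff m (G ^ (k + j)) := by
  rw [Polynomial.aeval_eq_sum_range' hN, Finset.mul_sum, map_sum]
  refine Finset.sum_congr rfl fun j _ => ?_
  rw [mul_smul_comm, ← pow_add, map_smul, smul_eq_mul]

-- This is the coefficient of X^d in (m+1)(kφ + Xφ')φ^m = (m+1)k φ^(m+1) + X(φ^(m+1))', the identity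
-- behind the induction in `lagrange_inversion`.
open Polynomial in
theorem sum_coeff_mul_coeff_pow (φ : ℝ[X]) (k m d N : ℕ) (hN : d < N) :
    ((m : ℝ) + 1) * ∑ j ∈ Finset.range N,
        φ.coeff j * (((k : ℝ) + j) * if j ≤ d then (φ ^ m).coeff (d - j) else 0) =
      (((m : ℝ) + 1) * k + d) * (φ ^ (m + 1)).coeff d := by
  have h1 : ∑ j ∈ Finset.range N,
        φ.coeff j * (((k : ℝ) + j) * if j ≤ d then (φ ^ m).coeff (d - j) else 0) =
      ((C (k : ℝ) * φ + X * derivative φ) * φ ^ m).coeff d := by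
    rw [coeff_mul, Finset.Nat.sum_antidiagonal_eq_sum_range_succ_mk]
    rw [← Finset.sum_subset (Finset.range_subset_range.2 (Nat.succ_le_of_lt hN))]
    · refine Finset.sum_congr rfl fun j hj => ?_
      rw [if_pos (by simpa [Nat.lt_succ_iff] using hj)]
      have : (C (k : ℝ) * φ + X * derivative φ).coeff j = (k + j) * φ.coeff j := by
        rw [coeff_add, coeff_C_mul]
        cases j with
        | zero => simp
        | succ j => rw [coeff_X_mul, coeff_derivative]; push_cast; ring
      simp only [this]; ring
    · intro j _ hj
      rw [if_neg (by simpa [Nat.lt_succ_iff] using hj)]; ring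
  have h2 : C ((m : ℝ) + 1) * ((C (k : ℝ) * φ + X * derivative φ) * φ ^ m) =
      C (((m : ℝ) + 1) * k) * φ ^ (m + 1) + X * derivative (φ ^ (m + 1)) := by
    rw [derivative_pow_succ]
    simp only [C_mul, C_add, map_one]; simp; ring
  have h3 : (X * derivative (φ ^ (m + 1))).coeff d = d * (φ ^ (m + 1)).coeff d := by
    cases d with
    | zero => simp
    | succ j => rw [coeff_X_mul, coeff_derivative]; push_cast; ring
  rw [h1, ← coeff_C_mul, h2, coeff_add, coeff_C_mul, h3]; ring

/-- Lagrange inversion for a polynomial `φ`. -/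
theorem lagrange_inversion {φ : Polynomial ℝ} {G : PowerSeries ℝ}
    (h : G = PowerSeries.X * Polynomial.aeval G φ) (m k : ℕ) :
    (m : ℝ) * PowerSeries.coeff m (G ^ k) =
      k * if k ≤ m then (φ ^ m).coeff (m - k) else 0 := by
  have h0 : PowerSeries.constantCoeff G = 0 := by rw [h]; simp
  induction m generalizing k with
  | zero => cases k <;> simp
  | succ m ih =>
    cases k with
    | zero => simp [PowerSeries.coeff_one]
    | succ k =>
      -- Replacing one factor G by X φ(G) lowers the degree by one. The range is long enough both
      -- for the degree of φ and for `sum_coeff_mul_coeff_pow` with d = m - k.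
      have h1 : PowerSeries.coeff (m + 1) (G ^ (k + 1)) =
          ∑ j ∈ Finset.range (φ.natDegree + 1 + m),
            φ.coeff j * PowerSeries.coeff m (G ^ (k + j)) := by
        rw [← coeff_mul_aeval_eq_sum φ k m _ (by omega), pow_succ]
        nth_rewrite 2 [h]
        rw [mul_left_comm, PowerSeries.coeff_succ_X_mul]
      -- The induction hypothesis carries a factor m and is empty at m = 0.
      rcases Nat.eq_zero_or_pos m with rfl | hm
      · rw [h1]
        rcases Nat.eq_zero_or_pos k with rfl | hk
        · rw [Finset.sum_eq_single 0]
          · simp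
          · intro j _ hj
            simp [h0, hj]
          · simp
        · rw [if_neg (by omega), Finset.sum_eq_zero]
          · simp
          · intro j _
            have : k + j ≠ 0 := by omega
            simp only [PowerSeries.coeff_zero_eq_constantCoeff_apply, map_pow, h0, zero_pow this,
              mul_zero]
      · have hm' : (m : ℝ) ≠ 0 := by positivity
        by_cases hk : k ≤ m
        · apply mul_left_cancel₀ hm'
          have h2 := sum_coeff_mul_coeff_pow φ k m (m - k) (φ.natDegree + 1 + m) (by omega)
          rw [h1, if_pos (by omega), Nat.add_sub_add_right, mul_left_comm, Finset.mul_sum]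
          have h3 : ∀ j ∈ Finset.range (φ.natDegree + 1 + m),
              (m : ℝ) * (φ.coeff j * PowerSeries.coeff m (G ^ (k + j))) =
                φ.coeff j * (((k : ℝ) + j) *
                  if j ≤ m - k then (φ ^ m).coeff (m - k - j) else 0) := by
            intro j _
            rw [mul_left_comm, ih]
            push_cast
            congr 2
            by_cases hj : k + j ≤ m
            · rw [if_pos hj, if_pos (by omega), Nat.sub_sub]
            · rw [if_neg hj, if_neg (by omega)]
          rw [Finset.sum_congr rfl h3]
          push_cast at h2 ⊢
          rw [h2, Nat.cast_sub hk]
          ring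
        · rw [h1, if_neg (by omega), Finset.sum_eq_zero]
          · simp
          · intro j _
            have := ih (k + j)
            rw [if_neg (by omega), mul_zero] at this
            rw [(mul_eq_zero.1 this).resolve_left hm', mul_zero]

end LagrangeInversion

/-! ### Weighted stack readings and their generating series. -/

section StackSum

/-- The sum of `f` over the nonempty suffixes of a list whose head has property `q`. -/
def suffixSum {α : Type*} (q : α → Prop) [DecidablePred q] (f : List α → ℝ) : List α → ℝ
  | [] => 0
  | s :: S => (if q s then f (s :: S) else 0) + suffixSum q f S

/-- The weighted number of ways to read `m` letters of alternating types, the first of type `t`,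
starting from the stack `S` of types: each letter either is pushed (weight `1`), or is matched
with a letter of its type in the stack, and then everything above is popped (weight `y t`). -/
def stackSum (y : Bool → ℝ) : Bool → ℕ → List Bool → ℝ
  | _, 0, _ => 1
  | t, m + 1, S => stackSum y (!t) m (t :: S) + y t * suffixSum (· = t) (stackSum y (!t) m) S

variable (y : Bool → ℝ)

theorem suffixSum_append {α : Type*} (q : α → Prop) [DecidablePred q] (f : List α → ℝ)
    (S T : List α) :
    suffixSum q f (S ++ T) = suffixSum q (fun U => f (U ++ T)) S + suffixSum q f T := by
  induction S with
  | nil => simp [suffixSum]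
  | cons s S ih => simp only [List.cons_append, suffixSum, ih]; ring

theorem suffixSum_add {α : Type*} (q : α → Prop) [DecidablePred q] (f g : List α → ℝ)
    (S : List α) : suffixSum q (fun U => f U + g U) S = suffixSum q f S + suffixSum q g S := by
  induction S with
  | nil => simp [suffixSum]
  | cons s S ih => simp only [suffixSum, ih]; split_ifs <;> ring

theorem suffixSum_mul {α : Type*} (q : α → Prop) [DecidablePred q] (f : List α → ℝ) (c : ℝ)
    (S : List α) : suffixSum q (fun U => f U * c) S = suffixSum q f S * c := by
  induction S with
  | nil => simp [suffixSum]
  | cons s S ih => simp only [suffixSum, ih]; split_ifs <;> ring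

theorem suffixSum_sum {α ι : Type*} (q : α → Prop) [DecidablePred q] (s : Finset ι)
    (f : ι → List α → ℝ) (S : List α) :
    suffixSum q (fun U => ∑ i ∈ s, f i U) S = ∑ i ∈ s, suffixSum q (f i) S := by
  induction S with
  | nil => simp [suffixSum]
  | cons a S ih =>
    simp only [suffixSum, ih, Finset.sum_add_distrib]
    split_ifs <;> simp

/-- The part of `stackSum y t (i + 1) S` in which the first letter is matched. -/
def matchSum (t : Bool) (i : ℕ) (S : List Bool) : ℝ :=
  y t * suffixSum (· = t) (stackSum y (!t) i) S

/-- First-passage decomposition: either no letter is matched inside T, or the first such match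
follows j letters read as if the stack were S alone. That match pops everything above it, so the
remainder depends on T only. The matching letter has type `not^[j] t`. -/
theorem stackSum_append (t : Bool) (m : ℕ) (S T : List Bool) :
    stackSum y t m (S ++ T) = stackSum y t m S +
      ∑ j ∈ Finset.range m, stackSum y t j S * matchSum y (not^[j] t) (m - 1 - j) T := by
  induction m generalizing t S with
  | zero => simp [stackSum]
  | succ m ih =>
    rw [stackSum, stackSum, suffixSum_append, ← List.cons_append, ih, Finset.sum_range_succ']
    have h1 : suffixSum (· = t) (fun U => stackSum y (!t) m (U ++ T)) S =
        suffixSum (· = t) (stackSum y (!t) m) S + ∑ j ∈ Finset.range m,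
          suffixSum (· = t) (stackSum y (!t) j) S *
            matchSum y (not^[j] (!t)) (m - 1 - j) T := by
      simp_rw [ih, suffixSum_add, suffixSum_sum, suffixSum_mul]
    have h2 : ∀ j ∈ Finset.range m, stackSum y t (j + 1) S *
          matchSum y (not^[j + 1] t) (m + 1 - 1 - (j + 1)) T =
        stackSum y (!t) j (t :: S) * matchSum y (not^[j] (!t)) (m - 1 - j) T +
          y t * (suffixSum (· = t) (stackSum y (!t) j) S *
            matchSum y (not^[j] (!t)) (m - 1 - j) T) := by
      intro j _
      rw [stackSum, Function.iterate_succ_apply,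
        show m + 1 - 1 - (j + 1) = m - 1 - j by omega]
      ring
    rw [h1, Finset.sum_congr rfl h2, Finset.sum_add_distrib, ← Finset.mul_sum]
    simp only [Function.iterate_zero, id, stackSum, matchSum]
    simp only [Nat.add_sub_cancel, Nat.sub_zero]
    ring

theorem sum_range_two_mul (f : ℕ → ℝ) (k : ℕ) :
    ∑ j ∈ Finset.range (2 * k), f j = ∑ i ∈ Finset.range k, (f (2 * i) + f (2 * i + 1)) := by
  induction k with
  | zero => simp
  | succ k ih => rw [Nat.mul_succ, Finset.sum_range_succ, Finset.sum_range_succ, ih,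
      Finset.sum_range_succ]; ring

theorem not_iterate_two_mul (t : Bool) (i : ℕ) : not^[2 * i] t = t := by
  rw [Function.iterate_mul]
  have : not^[2] = id := by ext b; simp
  rw [this]; simp

theorem matchSum_singleton_self (t : Bool) (i : ℕ) :
    matchSum y t i [t] = y t * stackSum y t (i + 1) [] := by
  simp [matchSum, suffixSum, stackSum]

theorem matchSum_singleton_not (t : Bool) (i : ℕ) : matchSum y (!t) i [t] = 0 := by
  simp [matchSum, suffixSum]

theorem stackSum_succ_nil (t : Bool) (m : ℕ) :
    stackSum y t (m + 1) [] = stackSum y (!t) m [] +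
      ∑ j ∈ Finset.range m, stackSum y (!t) j [] * matchSum y (not^[j] (!t)) (m - 1 - j) [t] := by
  rw [stackSum, ← List.nil_append [t], stackSum_append]
  simp [suffixSum]

theorem stackSum_odd (t : Bool) (k : ℕ) :
    stackSum y t (2 * k + 1) [] = stackSum y (!t) (2 * k) [] + y t * ∑ i ∈ Finset.range k,
      stackSum y (!t) (2 * i + 1) [] * stackSum y t (2 * (k - 1 - i) + 1) [] := by
  rw [stackSum_succ_nil, sum_range_two_mul, Finset.mul_sum]
  congr 1
  refine Finset.sum_congr rfl fun i hi => ?_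
  have := Finset.mem_range.1 hi
  rw [not_iterate_two_mul, matchSum_singleton_not, Function.iterate_succ_apply,
    not_iterate_two_mul, Bool.not_not, matchSum_singleton_self,
    show 2 * k - 1 - (2 * i + 1) + 1 = 2 * (k - 1 - i) + 1 by omega]
  ring

theorem stackSum_even (t : Bool) (k : ℕ) :
    stackSum y t (2 * k + 2) [] = stackSum y (!t) (2 * k + 1) [] + y t * ∑ i ∈ Finset.range k,
      stackSum y (!t) (2 * i + 1) [] * stackSum y t (2 * (k - i)) [] := by
  rw [stackSum_succ_nil, Finset.sum_range_succ, sum_range_two_mul, Finset.mul_sum,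
    not_iterate_two_mul, matchSum_singleton_not, mul_zero, add_zero]
  congr 1
  refine Finset.sum_congr rfl fun i hi => ?_
  have := Finset.mem_range.1 hi
  rw [not_iterate_two_mul, matchSum_singleton_not, Function.iterate_succ_apply,
    not_iterate_two_mul, Bool.not_not, matchSum_singleton_self,
    show 2 * k + 1 - 1 - (2 * i + 1) + 1 = 2 * (k - i) by omega]
  ring

open PowerSeries

/-- The generating series of `stackSum y t (2 * k) []`. -/
def evenSeries (t : Bool) : PowerSeries ℝ := PowerSeries.mk fun k => stackSum y t (2 * k) []

/-- The generating series of `stackSum y t (2 * k + 1) []`. -/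
def oddSeries (t : Bool) : PowerSeries ℝ := PowerSeries.mk fun k => stackSum y t (2 * k + 1) []

theorem oddSeries_eq (t : Bool) :
    oddSeries y t = evenSeries y (!t) + X * (C (y t) * (oddSeries y (!t) * oddSeries y t)) := by
  ext k
  rw [map_add]
  cases k with
  | zero => simp [oddSeries, evenSeries, stackSum, suffixSum]
  | succ k =>
    rw [coeff_succ_X_mul, coeff_C_mul, coeff_mul,
      Finset.Nat.sum_antidiagonal_eq_sum_range_succ_mk]
    simp only [oddSeries, evenSeries, coeff_mk]
    rw [stackSum_odd]
    simp

theorem evenSeries_eq (t : Bool) :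
    evenSeries y t = 1 + X * (oddSeries y (!t) +
      C (y t) * (oddSeries y (!t) * (evenSeries y t - 1))) := by
  ext k
  rw [map_add]
  cases k with
  | zero => simp [evenSeries, stackSum]
  | succ k =>
    rw [coeff_succ_X_mul, map_add, coeff_C_mul, coeff_mul,
      Finset.Nat.sum_antidiagonal_eq_sum_range_succ_mk, Finset.sum_range_succ]
    simp only [oddSeries, evenSeries, coeff_mk]
    rw [Nat.mul_succ, stackSum_even]
    have h0 : coeff 0 ((mk fun k => stackSum y t (2 * k) []) - 1 : PowerSeries ℝ) = 0 := by
      simp [stackSum]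
    rw [Nat.sub_self, h0, mul_zero, add_zero, coeff_one, if_neg (Nat.succ_ne_zero k), zero_add]
    congr 2
    refine Finset.sum_congr rfl fun i hi => ?_
    have := Finset.mem_range.1 hi
    rw [map_sub, coeff_one, if_neg (by omega), coeff_mk, sub_zero]

/-- The odd series are eliminated. Both even series solve the same linear equation (`hA`, `hB`), so
they agree. Then 1 + α(E - 1) and 1 + β(E - 1) are the inverses of 1 - XαO_B and 1 - XβO_A. -/
theorem evenSeries_sub_one_eq :
    evenSeries y true - 1 = X * ((1 + C (y true) * (evenSeries y true - 1)) *
      evenSeries y true * (1 + C (y false) * (evenSeries y true - 1))) := by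
  have hEA := evenSeries_eq y true
  have hEB := evenSeries_eq y false
  have hOA := oddSeries_eq y true
  have hOB := oddSeries_eq y false
  simp only [Bool.not_true, Bool.not_false] at hEA hEB hOA hOB
  set EA := evenSeries y true
  set EB := evenSeries y false
  set OA := oddSeries y true
  set OB := oddSeries y false
  set α : PowerSeries ℝ := C (y true)
  set β : PowerSeries ℝ := C (y false)
  have hA : EA * ((1 - X * α * OB) * (1 - X * β * OA) - X) =
      (1 - X * α * OB) * (1 - X * β * OA) := by
    linear_combination (1 - X * β * OA) * hEA + X * hOB
  have hB : EB * ((1 - X * α * OB) * (1 - X * β * OA) - X) =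
      (1 - X * α * OB) * (1 - X * β * OA) := by
    linear_combination (1 - X * α * OB) * hEB + X * hOA
  have hne : ((1 - X * α * OB) * (1 - X * β * OA) - X : PowerSeries ℝ) ≠ 0 := by
    intro h
    have := congrArg (constantCoeff (R := ℝ)) h
    simp at this
  have hE : EA = EB := mul_right_cancel₀ hne (hA.trans hB.symm)
  rw [← hE] at hEB hB hOA
  have h1 : (1 + α * (EA - 1)) * (1 - X * α * OB) = 1 := by linear_combination α * hEA
  have h2 : (1 + β * (EA - 1)) * (1 - X * β * OA) = 1 := by linear_combination β * hEB
  linear_combination (1 + α * (EA - 1)) * (1 + β * (EA - 1)) * hA -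
    (EA - 1) * (1 + β * (EA - 1)) * (1 - X * β * OA) * h1 - (EA - 1) * h2
end StackSum

/-! ### The main term as a coefficient of the stack series. -/

section MainTerm

open Polynomial in
theorem coeff_one_add_C_mul_X_pow (y : ℝ) (j i : ℕ) :
    ((1 + C y * X : ℝ[X]) ^ j).coeff i = y ^ i * j.choose i := by
  have : (1 + C y * X : ℝ[X]) = (1 + X).comp (C y * X) := by simp
  rw [this, ← pow_comp, comp_C_mul_X_coeff, coeff_one_add_X_pow, mul_comm]

open Polynomial in
theorem coeff_one_add_C_mul_X_mul_pow (y : ℝ) (ψ : ℝ[X]) (l d : ℕ) :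
    (((1 + C y * X) * ψ) ^ l).coeff d =
      ∑ j ∈ Finset.range (d + 1), y ^ j * l.choose j * (ψ ^ l).coeff (d - j) := by
  rw [mul_pow, coeff_mul, Finset.Nat.sum_antidiagonal_eq_sum_range_succ_mk]
  simp only [coeff_one_add_C_mul_X_pow]

/-- The polynomial `(1 + X) (1 + y X)`. -/
noncomputable def mpPoly (y : ℝ) : Polynomial ℝ :=
  (1 + Polynomial.C y * Polynomial.X) * (1 + Polynomial.X)

/-- The generating series of the moments of the Marchenko-Pastur distribution. -/
noncomputable def mpSeries (y : ℝ) : PowerSeries ℝ := evenSeries (fun t => if t then 0 else y) true - 1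

/-- Weight 0 on one of the two types degenerates the cubic equation to the quadratic one of the
Marchenko–Pastur law. -/
theorem mpSeries_eq (y : ℝ) :
    mpSeries y = PowerSeries.X * Polynomial.aeval (mpSeries y) (mpPoly y) := by
  conv_lhs => rw [mpSeries, evenSeries_sub_one_eq]
  simp only [mpPoly, mpSeries, if_true, map_mul, map_add, map_one, map_zero,
    Polynomial.aeval_X, Polynomial.aeval_C, Bool.false_eq_true, if_false]
  rw [show (algebraMap ℝ (PowerSeries ℝ)) y = PowerSeries.C y from rfl]
  ring

theorem coeff_mpSeries {j : ℕ} (hj : 1 ≤ j) (y : ℝ) :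
    PowerSeries.coeff j (mpSeries y) = mpMoment j y := by
  have hj' : (j : ℝ) ≠ 0 := by positivity
  apply mul_left_cancel₀ hj'
  have h := lagrange_inversion (mpSeries_eq y) j 1
  rw [pow_one, if_pos hj, mpPoly, coeff_one_add_C_mul_X_mul_pow,
    Nat.sub_add_cancel hj] at h
  rw [h, mpMoment, Nat.cast_one, one_mul, Finset.mul_sum]
  refine Finset.sum_congr rfl fun i hi => ?_
  have hi := Finset.mem_range.1 hi
  rw [Polynomial.coeff_one_add_X_pow]
  have h1 : j.choose (j - 1 - i) = j.choose (i + 1) := by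
    rw [← Nat.choose_symm (by omega : i + 1 ≤ j)]; congr 1; omega
  obtain ⟨k, rfl⟩ : ∃ k, j = k + 1 := ⟨j - 1, by omega⟩
  have h2 := Nat.add_one_mul_choose_eq k i
  have h3 : ((k : ℝ) + 1) * k.choose i = (k + 1).choose (i + 1) * (i + 1) := by exact_mod_cast h2
  rw [h1, Nat.add_sub_cancel]
  push_cast
  field_simp
  linear_combination (-(y ^ i * ((k + 1).choose i : ℝ))) * h3

theorem constantCoeff_mpSeries (y : ℝ) : PowerSeries.constantCoeff (mpSeries y) = 0 := by
  rw [mpSeries_eq]; simp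

/-- The truncation of `mpSeries y` in degrees `≤ i`. -/
noncomputable def mpTrunc (i : ℕ) (y : ℝ) : PowerSeries ℝ :=
  ∑ j : Fin i, PowerSeries.C (mpMoment (j + 1) y) * PowerSeries.X ^ ((j : ℕ) + 1)

theorem coeff_mpTrunc (i m : ℕ) (y : ℝ) (hm : m ≤ i) :
    PowerSeries.coeff m (mpTrunc i y) = PowerSeries.coeff m (mpSeries y) := by
  rw [mpTrunc, map_sum]
  simp only [PowerSeries.coeff_C_mul, PowerSeries.coeff_X_pow]
  cases m with
  | zero => simp [constantCoeff_mpSeries]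
  | succ m =>
    rw [Finset.sum_eq_single ⟨m, hm⟩]
    · simp [coeff_mpSeries]
    · intro j _ hj
      rw [if_neg, mul_zero]
      intro h
      exact hj (Fin.ext (by simp only; omega))
    · simp

theorem X_dvd_mpSeries (y : ℝ) : PowerSeries.X ∣ mpSeries y := ⟨_, mpSeries_eq y⟩

theorem X_dvd_mpTrunc (i : ℕ) (y : ℝ) : PowerSeries.X ∣ mpTrunc i y :=
  Finset.dvd_sum fun _ _ => Dvd.dvd.mul_left (dvd_pow_self _ (Nat.succ_ne_zero _)) _

/-- Each of the b factors is divisible by X, so in degree i + b - 1 no factor contributes a degree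
above i. This is why only k_1, …, k_i occur in the main term. -/
theorem coeff_mpTrunc_pow (i b : ℕ) (hb : 1 ≤ b) (y : ℝ) :
    PowerSeries.coeff (i + b - 1) (mpTrunc i y ^ b) =
      PowerSeries.coeff (i + b - 1) (mpSeries y ^ b) := by
  have h1 : (PowerSeries.X : PowerSeries ℝ) ^ (i + 1) ∣ mpTrunc i y - mpSeries y := by
    rw [PowerSeries.X_pow_dvd_iff]
    intro m hm
    rw [map_sub, coeff_mpTrunc i m y (by omega), sub_self]
  have h2 : (PowerSeries.X : PowerSeries ℝ) ^ (b - 1) ∣ ∑ s ∈ Finset.range b,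
      mpTrunc i y ^ s * mpSeries y ^ (b - 1 - s) := by
    refine Finset.dvd_sum fun s hs => ?_
    have := Finset.mem_range.1 hs
    rw [show b - 1 = s + (b - 1 - s) by omega, pow_add]
    simp only [Nat.add_sub_cancel_left]
    exact mul_dvd_mul (pow_dvd_pow_of_dvd (X_dvd_mpTrunc i y) _)
      (pow_dvd_pow_of_dvd (X_dvd_mpSeries y) _)
  have h3 := mul_dvd_mul h2 h1
  rw [geom_sum₂_mul, ← pow_add, PowerSeries.X_pow_dvd_iff] at h3
  have := h3 (i + b - 1) (by omega)
  rwa [map_sub, sub_eq_zero] at this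

theorem coeff_mpTrunc_pow_eq_sum (i b l : ℕ) (y : ℝ) :
    PowerSeries.coeff l (mpTrunc i y ^ b) =
      ∑ k ∈ (Finset.piAntidiag (Finset.univ : Finset (Fin i)) b).filter
        (fun k : Fin i → ℕ => ∑ j : Fin i, ((j : ℕ) + 1) * k j = l),
      (b.factorial : ℝ) * ∏ j : Fin i, mpMoment ((j : ℕ) + 1) y ^ k j / ((k j).factorial : ℝ) := by
  rw [mpTrunc, Finset.sum_pow_eq_sum_piAntidiag, map_sum, Finset.sum_filter]
  refine Finset.sum_congr rfl fun k hk => ?_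
  rw [Finset.mem_piAntidiag] at hk
  have h1 : ∏ j : Fin i, (PowerSeries.C (mpMoment (j + 1) y) *
        (PowerSeries.X : PowerSeries ℝ) ^ ((j : ℕ) + 1)) ^ k j =
      PowerSeries.C (∏ j : Fin i, mpMoment (j + 1) y ^ k j) *
        PowerSeries.X ^ (∑ j : Fin i, ((j : ℕ) + 1) * k j) := by
    simp only [mul_pow, Finset.prod_mul_distrib, ← pow_mul, Finset.prod_pow_eq_pow_sum, map_prod,
      map_pow]
  have h2 := Nat.multinomial_spec Finset.univ k
  rw [hk.1] at h2
  have h3 : (∏ j : Fin i, ((k j).factorial : ℝ)) ≠ 0 :=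
    Finset.prod_ne_zero_iff.2 fun j _ => by positivity
  have h4 : (∏ j : Fin i, ((k j).factorial : ℝ)) * (Nat.multinomial Finset.univ k : ℝ) =
      b.factorial := by exact_mod_cast h2
  rw [h1, ← map_natCast (PowerSeries.C (R := ℝ)), PowerSeries.coeff_C_mul, PowerSeries.coeff_C_mul,
    PowerSeries.coeff_X_pow, Finset.prod_div_distrib, ← h4]
  by_cases h : ∑ j : Fin i, ((j : ℕ) + 1) * k j = l
  · rw [if_pos h.symm, if_pos h]; field_simp
  · rw [if_neg (Ne.symm h), if_neg h]; simp

/-- For b = l - i + 1 the inner sum is l!/(i! b!) times the coefficient of X^l in the b-th power of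
the moment series. Lagrange inversion gives b/l times a coefficient of `mpPoly yb ^ l`, and the
factorials combine to a binomial coefficient over l. -/
theorem mainTerm_eq_sum {l : ℕ} (hl : 1 ≤ l) (ya yb : ℝ) :
    mainTerm l ya yb = ya / l * ∑ j ∈ Finset.range l,
      ya ^ j * l.choose j * ((mpPoly yb) ^ l).coeff (l - 1 - j) := by
  have hI : Finset.Icc 1 l = Finset.Ico (0 + 1) (l + 1) := by
    ext i; simp only [Finset.mem_Icc, Finset.mem_Ico]; omega
  rw [mainTerm, ← Finset.sum_range_reflect, Finset.mul_sum, Finset.range_eq_Ico, hI,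
    ← Finset.sum_Ico_add' _ 0 l 1]
  refine Finset.sum_congr rfl fun x hx => ?_
  -- The index of the main term is i = x + 1, and c = l - i.
  obtain ⟨c, rfl⟩ : ∃ c, l = x + c + 1 := ⟨l - x - 1, by have := (Finset.mem_Ico.1 hx).2; omega⟩
  rw [show x + c + 1 - (x + 1) + 1 = c + 1 by omega, show x + c + 1 - 1 - x = c by omega,
    show x + c + 1 - 1 - c = x by omega]
  have h1 := coeff_mpTrunc_pow_eq_sum (x + 1) (c + 1) (x + c + 1) yb
  have h2 := coeff_mpTrunc_pow (x + 1) (c + 1) (by omega) yb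
  rw [show x + 1 + (c + 1) - 1 = x + c + 1 by omega, h1, ← Finset.mul_sum] at h2
  have h3 := lagrange_inversion (mpSeries_eq yb) (x + c + 1) (c + 1)
  rw [if_pos (by omega), ← h2, show x + c + 1 - (c + 1) = x by omega] at h3
  have h4 : ((x + c + 1).choose c : ℝ) * c.factorial * (x + 1).factorial =
      (x + c + 1).factorial := by
    have := Nat.choose_mul_factorial_mul_factorial (by omega : c ≤ x + c + 1)
    rw [show x + c + 1 - c = x + 1 by omega] at this
    exact_mod_cast this
  have h5 : ((c + 1).factorial : ℝ) = (c + 1) * c.factorial := by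
    rw [Nat.factorial_succ]; push_cast; ring
  rw [← Finset.mul_sum]
  set S := ∑ k ∈ (Finset.piAntidiag (Finset.univ : Finset (Fin (x + 1))) (c + 1)).filter
        (fun k : Fin (x + 1) → ℕ => ∑ j : Fin (x + 1), ((j : ℕ) + 1) * k j = x + c + 1),
      ∏ j : Fin (x + 1), mpMoment ((j : ℕ) + 1) yb ^ k j / ((k j).factorial : ℝ)
  have hc : (c : ℝ) + 1 ≠ 0 := by positivity
  have h6 : (((x + c + 1 : ℕ) : ℝ)) * (c.factorial * S) = (mpPoly yb ^ (x + c + 1)).coeff x := by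
    apply mul_left_cancel₀ hc
    rw [h5] at h3
    push_cast at h3 ⊢
    linear_combination h3
  rw [← h6, ← h4]
  have : ((x + c + 1 : ℕ) : ℝ) ≠ 0 := by positivity
  field_simp
  ring

theorem mainTerm_eq_coeff {l : ℕ} (hl : 1 ≤ l) (y : Bool → ℝ) :
    mainTerm l (y true) (y false) = y true * stackSum y true (2 * l) [] := by
  have hG : evenSeries y true - 1 = PowerSeries.X * Polynomial.aeval (evenSeries y true - 1)
      ((1 + Polynomial.C (y true) * Polynomial.X) * mpPoly (y false)) := by
    conv_lhs => rw [evenSeries_sub_one_eq]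
    simp only [mpPoly, map_mul, map_add, map_one, Polynomial.aeval_X, Polynomial.aeval_C]
    have hC : ∀ z, algebraMap ℝ (PowerSeries ℝ) z = PowerSeries.C z := fun _ => rfl
    simp only [hC]
    ring
  have hl' : (l : ℝ) ≠ 0 := by positivity
  have h := lagrange_inversion hG l 1
  rw [pow_one, if_pos hl, coeff_one_add_C_mul_X_mul_pow, Nat.sub_add_cancel hl, map_sub,
    PowerSeries.coeff_one, if_neg (by omega), sub_zero, evenSeries, PowerSeries.coeff_mk] at h
  rw [mainTerm_eq_sum hl]
  apply mul_left_cancel₀ hl'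
  rw [mul_left_comm (l : ℝ) (y true), h]
  field_simp
  simp
end MainTerm

/-! ### The stack automaton, and its stability under undoing the reductions. -/

section StackAutomaton

variable {K : Type*} [DecidableEq K]

/-- A word is accepted from the stack `S` and the set `D` of forbidden letters if it can be read
without meeting a forbidden letter, where a letter outside the stack is pushed, and a letter of
the stack is kept while everything above it is popped and becomes forbidden. -/
def stackAccepts : List K → Finset K → List K → Prop
  | _, _, [] => True
  | S, D, a :: w => a ∉ D ∧ if a ∈ S then
      stackAccepts (S.dropWhile (· ≠ a)) (D ∪ (S.takeWhile (· ≠ a)).toFinset) w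
    else stackAccepts (a :: S) D w

/-- The weight `N ^ r` of an accepted word in which `r` letters are matched with the stack, and
`0` for words that are not accepted. -/
def stackWeight (N : ℝ) : List K → Finset K → List K → ℝ
  | _, _, [] => 1
  | S, D, a :: w => if a ∈ D then 0 else if a ∈ S then
      N * stackWeight N (S.dropWhile (· ≠ a)) (D ∪ (S.takeWhile (· ≠ a)).toFinset) w
    else stackWeight N (a :: S) D w

theorem stackAccepts_nil (S : List K) (D : Finset K) : stackAccepts S D [] := by
  rw [stackAccepts]; trivial

theorem takeWhile_ne_append {a : K} {T S : List K} (h : a ∉ T) :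
    (T ++ a :: S).takeWhile (· ≠ a) = T := by
  rw [List.takeWhile_append_of_pos (fun b hb => by
    simpa using ne_of_mem_of_not_mem hb h)]
  simp

theorem dropWhile_ne_append {a : K} {T S : List K} (h : a ∉ T) :
    (T ++ a :: S).dropWhile (· ≠ a) = a :: S := by
  rw [List.dropWhile_append_of_pos (fun b hb => by
    simpa using ne_of_mem_of_not_mem hb h)]
  simp

theorem stackAccepts_match {a : K} {T S : List K} {D : Finset K} {w : List K} (h : a ∉ T) :
    stackAccepts (T ++ a :: S) D (a :: w) ↔
      a ∉ D ∧ stackAccepts (a :: S) (D ∪ T.toFinset) w := by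
  rw [stackAccepts, if_pos (by simp), takeWhile_ne_append h, dropWhile_ne_append h]

theorem stackAccepts_push {a : K} {S : List K} {D : Finset K} {w : List K} (h : a ∉ S) :
    stackAccepts S D (a :: w) ↔ a ∉ D ∧ stackAccepts (a :: S) D w := by
  rw [stackAccepts, if_neg h]

theorem stackWeight_match {N : ℝ} {a : K} {T S : List K} {D : Finset K} {w : List K}
    (h : a ∉ T) (hD : a ∉ D) : stackWeight N (T ++ a :: S) D (a :: w) =
      N * stackWeight N (a :: S) (D ∪ T.toFinset) w := by
  rw [stackWeight, if_neg hD, if_pos (by simp), takeWhile_ne_append h, dropWhile_ne_append h]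

theorem stackWeight_push {N : ℝ} {a : K} {S : List K} {D : Finset K} {w : List K}
    (h : a ∉ S) (hD : a ∉ D) : stackWeight N S D (a :: w) = stackWeight N (a :: S) D w := by
  rw [stackWeight, if_neg hD, if_neg h]

theorem stackWeight_of_not_accepts (N : ℝ) {S : List K} {D : Finset K} {w : List K}
    (h : ¬ stackAccepts S D w) : stackWeight N S D w = 0 := by
  induction w generalizing S D with
  | nil => exact absurd (stackAccepts_nil S D) h
  | cons a w ih =>
    rw [stackAccepts] at h
    rw [stackWeight]
    by_cases hD : a ∈ D
    · rw [if_pos hD]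
    · rw [if_neg hD]
      by_cases hS : a ∈ S
      · rw [if_pos hS] at h ⊢
        rw [ih fun h' => h ⟨hD, h'⟩, mul_zero]
      · rw [if_neg hS] at h ⊢
        exact ih fun h' => h ⟨hD, h'⟩

theorem not_mem_of_stackAccepts {S : List K} {D : Finset K} {w : List K}
    (h : stackAccepts S D w) : ∀ a ∈ w, a ∉ D := by
  induction w generalizing S D with
  | nil => simp
  | cons b w ih =>
    intro a ha
    rw [stackAccepts] at h
    rcases List.mem_cons.1 ha with rfl | ha
    · exact h.1
    · by_cases hS : b ∈ S
      · rw [if_pos hS] at h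
        exact fun hD => ih h.2 a ha (Finset.mem_union_left _ hD)
      · rw [if_neg hS] at h
        exact ih h.2 a ha

theorem stackAccepts_mono {S : List K} {D D' : Finset K} {w : List K}
    (h : stackAccepts S D w) (hD : ∀ a ∈ w, a ∈ D' → a ∈ D) : stackAccepts S D' w := by
  induction w generalizing S D D' with
  | nil => exact stackAccepts_nil S D'
  | cons b w ih =>
    rw [stackAccepts] at h ⊢
    refine ⟨fun hb => h.1 (hD b (by simp) hb), ?_⟩
    by_cases hS : b ∈ S
    · rw [if_pos hS] at h ⊢
      refine ih h.2 fun a ha haD => ?_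
      rcases Finset.mem_union.1 haD with h' | h'
      · exact Finset.mem_union_left _ (hD a (by simp [ha]) h')
      · exact Finset.mem_union_right _ h'
    · rw [if_neg hS] at h ⊢
      exact ih h.2 fun a ha => hD a (by simp [ha])

/-- A stack letter that does not recur in w is inert: at most it is popped, and forbidding it then
costs nothing. -/
theorem stackAccepts_insert_stack {S T : List K} {D : Finset K} {a : K} {w : List K}
    (h : stackAccepts (S ++ T) D w) (ha : a ∉ w) : stackAccepts (S ++ a :: T) D w := by
  induction w generalizing S T D with
  | nil => exact stackAccepts_nil _ D
  | cons b w ih =>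
    have hab : b ≠ a := fun e => ha (by simp [e])
    have haw : a ∉ w := fun e => ha (by simp [e])
    by_cases hS : b ∈ S
    · obtain ⟨S₁, S₂, rfl, hb⟩ := List.eq_append_cons_of_mem hS
      rw [List.append_assoc, List.cons_append, stackAccepts_match hb] at h
      rw [List.append_assoc, List.cons_append, stackAccepts_match hb]
      exact ⟨h.1, ih (S := b :: S₂) h.2 haw⟩
    · by_cases hT : b ∈ T
      · obtain ⟨T₁, T₂, rfl, hb⟩ := List.eq_append_cons_of_mem hT
        rw [← List.append_assoc, stackAccepts_match (by simp [hS, hb])] at h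
        rw [show S ++ a :: (T₁ ++ b :: T₂) = (S ++ a :: T₁) ++ b :: T₂ by simp,
          stackAccepts_match (by simp [hS, hb, hab])]
        refine ⟨h.1, stackAccepts_mono h.2 fun c hc => ?_⟩
        have : c ≠ a := fun e => haw (e ▸ hc)
        simp [this]
      · rw [stackAccepts_push (by simp [hS, hT])] at h
        rw [stackAccepts_push (by simp [hS, hT, hab])]
        exact ⟨h.1, ih (S := b :: S) h.2 haw⟩

/-- Together with `stackAccepts_double`, this runs the reductions backwards: a word that is not
accepted stays so when reduced. -/
theorem stackAccepts_insert {S : List K} {D : Finset K} {a : K} {u v : List K}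
    (h : stackAccepts S D (u ++ v)) (hu : a ∉ u) (hv : a ∉ v) (hD : a ∉ D) (hS : a ∉ S) :
    stackAccepts S D (u ++ a :: v) := by
  induction u generalizing S D with
  | nil =>
    rw [List.nil_append] at h ⊢
    rw [stackAccepts_push hS]
    exact ⟨hD, stackAccepts_insert_stack (S := []) h hv⟩
  | cons b u ih =>
    have hab : a ≠ b := fun e => hu (by simp [e])
    have hau : a ∉ u := fun e => hu (by simp [e])
    rw [List.cons_append] at h ⊢
    by_cases hb : b ∈ S
    · obtain ⟨S₁, S₂, rfl, hb'⟩ := List.eq_append_cons_of_mem hb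
      rw [stackAccepts_match hb'] at h ⊢
      simp only [List.mem_append, List.mem_cons, not_or] at hS
      exact ⟨h.1, ih h.2 hau (by simp [hD, hS.1]) (by simp [hab, hS.2])⟩
    · rw [stackAccepts_push hb] at h ⊢
      exact ⟨h.1, ih h.2 hau hD (by simp [hab, hS])⟩

theorem stackAccepts_double {S : List K} {D : Finset K} {a : K} {u v : List K}
    (h : stackAccepts S D (u ++ a :: v)) : stackAccepts S D (u ++ a :: a :: v) := by
  induction u generalizing S D with
  | nil =>
    rw [List.nil_append] at h ⊢
    -- Once read, a is on top of the stack, so a second a pops nothing.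
    have key : ∀ {T D'}, a ∉ D' → stackAccepts (a :: T) D' v →
        stackAccepts (a :: T) D' (a :: v) := by
      intro T D' hD' h'
      rw [← List.nil_append (a :: T), stackAccepts_match (by simp)]
      exact ⟨hD', by simpa using h'⟩
    by_cases hS : a ∈ S
    · obtain ⟨S₁, S₂, rfl, ha⟩ := List.eq_append_cons_of_mem hS
      rw [stackAccepts_match ha] at h ⊢
      exact ⟨h.1, key (by simp [h.1, ha]) h.2⟩
    · rw [stackAccepts_push hS] at h ⊢
      exact ⟨h.1, key h.1 h.2⟩
  | cons b u ih =>
    rw [List.cons_append] at h ⊢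
    by_cases hb : b ∈ S
    · obtain ⟨S₁, S₂, rfl, hb'⟩ := List.eq_append_cons_of_mem hb
      rw [stackAccepts_match hb'] at h ⊢
      exact ⟨h.1, ih h.2⟩
    · rw [stackAccepts_push hb] at h ⊢
      exact ⟨h.1, ih h.2⟩

end StackAutomaton

/-! ### Averaged traces of words and their two reductions. -/

section RandomWords

variable {K : Type*} [Fintype K] [DecidableEq K] {Ω : K → Type*} [∀ k, Fintype (Ω k)]
  {V : Type*} [AddCommGroup V] {ι : Type*} [Fintype ι] [DecidableEq ι]

/-- The rank one matrix with entries `χ (e s - e t)`. -/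
def stepMatrix (e : ι → V) (χ : AddChar V ℂ) : Matrix ι ι ℂ :=
  Matrix.of fun t s => χ (e s - e t)

/-- The average over `ω` of the trace of the product of the matrices `stepMatrix e (χ k (ω k))`
along a word in the letters `k`. -/
noncomputable def wordTrace (e : ι → V) (χ : ∀ k, Ω k → AddChar V ℂ) (w : List K) : ℂ :=
  (∑ ω : ∀ k, Ω k, (w.map fun k => stepMatrix e (χ k (ω k))).prod.trace) /
    Fintype.card (∀ k, Ω k)

/-- The hypotheses on the characters `χ k x`: for each `k` they average to the indicator of a
subgroup `Λ k`, modulo which sums of two of the vectors `e t` are distinct. -/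
structure IsFourWise (e : ι → V) (χ : ∀ k, Ω k → AddChar V ℂ) (Λ : K → AddSubgroup V) :
    Prop where
  mean : ∀ k v, v ∈ Λ k → ∑ x, χ k x v = Fintype.card (Ω k)
  mean_zero : ∀ k v, v ∉ Λ k → ∑ x, χ k x v = 0
  eq_of_sub_mem : ∀ k s t, e s - e t ∈ Λ k → s = t
  eq_or_eq_of_sub_mem : ∀ k s t s' t', s ≠ t → s' ≠ t' →
    (e s - e t) - (e s' - e t') ∈ Λ k → t' = t ∨ t' = s

theorem stepMatrix_mul_self (e : ι → V) (χ : AddChar V ℂ) :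
    stepMatrix e χ * stepMatrix e χ = (Fintype.card ι : ℂ) • stepMatrix e χ := by
  ext t s
  simp only [stepMatrix, Matrix.mul_apply, Matrix.of_apply, Matrix.smul_apply, smul_eq_mul]
  rw [Finset.sum_congr rfl (g := fun _ => χ (e s - e t))]
  · simp
  · intro r _
    rw [← AddChar.map_add_eq_mul]; congr 1; abel

/-- Exchanging the coordinate `ω a` with an independent copy x is an involution. -/
theorem sum_sum_update (a : K) (f : (∀ k, Ω k) → ℂ) :
    ∑ ω, ∑ x, f (Function.update ω a x) = Fintype.card (Ω a) * ∑ ω, f ω := by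
  rw [← Fintype.sum_prod_type' (f := fun ω x => f (Function.update ω a x))]
  have : ∑ z : (∀ k, Ω k) × Ω a, f z.1 = Fintype.card (Ω a) * ∑ ω, f ω := by
    rw [Fintype.sum_prod_type, Finset.mul_sum]
    simp
  rw [← this]
  refine Finset.sum_nbij' (fun z => (Function.update z.1 a z.2, z.1 a))
    (fun z => (Function.update z.1 a z.2, z.1 a)) ?_ ?_ ?_ ?_ ?_ <;> simp

variable {e : ι → V} {χ : ∀ k, Ω k → AddChar V ℂ} {Λ : K → AddSubgroup V}

theorem IsFourWise.sum_stepMatrix (h : IsFourWise e χ Λ) (a : K) :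
    ∑ x, stepMatrix e (χ a x) = (Fintype.card (Ω a) : ℂ) • 1 := by
  ext t s
  rw [Matrix.sum_apply]
  simp only [stepMatrix, Matrix.of_apply, Matrix.smul_apply, smul_eq_mul]
  by_cases hts : t = s
  · subst hts
    rw [h.mean a _ (by simp)]; simp
  · rw [h.mean_zero a _ fun hm => hts (h.eq_of_sub_mem a s t hm).symm]; simp [hts]

theorem map_stepMatrix_update (ω : ∀ k, Ω k) {a : K} (x : Ω a) {w : List K} (h : a ∉ w) :
    (w.map fun k => stepMatrix e (χ k (Function.update ω a x k))) =
      w.map fun k => stepMatrix e (χ k (ω k)) := by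
  refine List.map_congr_left fun k hk => ?_
  rw [Function.update_of_ne (ne_of_mem_of_not_mem hk h)]

theorem IsFourWise.wordTrace_insert [∀ k, Nonempty (Ω k)] (h : IsFourWise e χ Λ) {a : K}
    {u v : List K} (hu : a ∉ u) (hv : a ∉ v) :
    wordTrace e χ (u ++ a :: v) = wordTrace e χ (u ++ v) := by
  have hc : (Fintype.card (Ω a) : ℂ) ≠ 0 := by simp
  rw [wordTrace, wordTrace]
  congr 1
  apply mul_left_cancel₀ hc
  rw [← sum_sum_update a, Finset.mul_sum]
  refine Finset.sum_congr rfl fun ω _ => ?_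
  simp only [List.map_append, List.map_cons, List.prod_append, List.prod_cons,
    map_stepMatrix_update ω _ hu, map_stepMatrix_update ω _ hv, Function.update_self]
  rw [← Matrix.trace_sum, ← Finset.mul_sum, ← Finset.sum_mul, h.sum_stepMatrix]
  simp

theorem wordTrace_double (a : K) (u v : List K) :
    wordTrace e χ (u ++ a :: a :: v) = Fintype.card ι * wordTrace e χ (u ++ a :: v) := by
  rw [wordTrace, wordTrace, mul_div_assoc', Finset.mul_sum]
  congr 1
  refine Finset.sum_congr rfl fun ω _ => ?_
  simp only [List.map_append, List.map_cons, List.prod_append, List.prod_cons]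
  rw [← mul_assoc (stepMatrix e (χ a (ω a))), stepMatrix_mul_self]
  simp

theorem IsFourWise.wordTrace_insert_list [∀ k, Nonempty (Ω k)] (h : IsFourWise e χ Λ)
    {T : List K} (hT : T.Nodup) {u v : List K} (hu : ∀ a ∈ T, a ∉ u) (hv : ∀ a ∈ T, a ∉ v) :
    wordTrace e χ (u ++ (T ++ v)) = wordTrace e χ (u ++ v) := by
  induction T with
  | nil => simp
  | cons a T ih =>
    rw [List.nodup_cons] at hT
    rw [List.cons_append, h.wordTrace_insert (hu a (by simp))
      (by simp [hT.1, hv a (by simp)]), ih hT.2 (fun b hb => hu b (by simp [hb]))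
      (fun b hb => hv b (by simp [hb]))]

/-- The stack, read from the bottom, is what remains of the prefix already processed. At a match the
popped letters occur once and are forbidden afterwards, so they average away. The two copies of the
matched letter become adjacent, and merging them gives one factor of the dimension. The final stack
averages away too and leaves the trace of the identity. -/
theorem IsFourWise.wordTrace_of_accepts [∀ k, Nonempty (Ω k)] (h : IsFourWise e χ Λ)
    {S : List K} {D : Finset K} {w : List K} (hS : S.Nodup) (hw : stackAccepts S D w) :
    wordTrace e χ (S.reverse ++ w) =
      Fintype.card ι * (stackWeight (Fintype.card ι : ℝ) S D w : ℂ) := by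
  induction w generalizing S D with
  | nil =>
    have := h.wordTrace_insert_list (u := []) (v := []) (List.nodup_reverse.2 hS)
      (by simp) (by simp)
    rw [List.nil_append] at this
    have hc : (Fintype.card (∀ k, Ω k) : ℂ) ≠ 0 := by exact_mod_cast Fintype.card_ne_zero
    rw [this]
    simp only [wordTrace, stackWeight, List.append_nil, List.map_nil, List.prod_nil,
      Matrix.trace_one, Finset.sum_const, Finset.card_univ, nsmul_eq_mul, Complex.ofReal_one,
      mul_one]
    field_simp
  | cons a w ih =>
    by_cases haS : a ∈ S
    · obtain ⟨T, S', rfl, ha⟩ := List.eq_append_cons_of_mem haS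
      rw [stackAccepts_match ha] at hw
      rw [stackWeight_match ha hw.1]
      have hn := List.nodup_append.1 hS
      have hn' := List.nodup_cons.1 hn.2.1
      have h1 : (T ++ a :: S').reverse ++ a :: w =
          (S'.reverse ++ [a]) ++ (T.reverse ++ a :: w) := by simp
      have h2 : S'.reverse ++ [a] ++ a :: w = S'.reverse ++ a :: a :: w := by simp
      rw [h1, h.wordTrace_insert_list (List.nodup_reverse.2 hn.1), h2, wordTrace_double]
      · have := ih hn.2.1 hw.2
        rw [List.reverse_cons, List.append_assoc, List.singleton_append] at this
        rw [this]
        push_cast; ring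
      · intro b hb hb'
        have hbT := List.mem_reverse.1 hb
        have := hn.2.2 b hbT b
        simp only [List.mem_append, List.mem_reverse, List.mem_singleton] at hb'
        rcases hb' with hb' | hb'
        · exact this (by simp [hb']) rfl
        · exact this (by simp [hb']) rfl
      · intro b hb hb'
        have hbT := List.mem_reverse.1 hb
        rcases List.mem_cons.1 hb' with rfl | hb'
        · exact ha hbT
        · exact not_mem_of_stackAccepts hw.2 b hb' (by simp [hbT])
    · rw [stackAccepts_push haS] at hw
      rw [stackWeight_push haS hw.1, ← ih (List.nodup_cons.2 ⟨haS, hS⟩) hw.2]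
      simp

end RandomWords

/-! ### Traces as counts of closed paths. -/

section ClosedPaths

variable {K : Type*} [Fintype K] [DecidableEq K] {Ω : K → Type*} [∀ k, Fintype (Ω k)]
  {V : Type*} [AddCommGroup V] {ι : Type*} [Fintype ι] [DecidableEq ι]
  {e : ι → V} {χ : ∀ k, Ω k → AddChar V ℂ} {Λ : K → AddSubgroup V}

theorem prod_ofFn_apply {R : Type*} [CommSemiring R] (m : ℕ) (M : Fin (m + 1) → Matrix ι ι R)
    (a b : ι) : (List.ofFn M).prod a b =
      ∑ u : Fin m → ι, ∏ i, M i (Fin.cons (α := fun _ => ι) a u i)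
        (Fin.snoc (α := fun _ => ι) u b i) := by
  induction m generalizing a with
  | zero => simp [Fin.snoc]
  | succ m ih =>
    rw [List.ofFn_succ, List.prod_cons, Matrix.mul_apply,
      ← (Fin.consEquiv fun _ => ι).sum_comp, Fintype.sum_prod_type]
    refine Finset.sum_congr rfl fun c _ => ?_
    rw [ih, Finset.mul_sum]
    refine Finset.sum_congr rfl fun u _ => ?_
    symm
    change ∏ i, M i (Fin.cons (α := fun _ => ι) a (Fin.cons (α := fun _ => ι) c u) i)
      (Fin.snoc (α := fun _ => ι) (Fin.cons (α := fun _ => ι) c u) b i) = _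
    rw [Fin.prod_univ_succ, ← Fin.cons_snoc_eq_snoc_cons]
    simp only [Fin.cons_zero, Fin.cons_succ]

/-- Addition in `Fin (m + 1)` wraps around, which closes the path. -/
theorem trace_prod_ofFn {R : Type*} [CommSemiring R] (m : ℕ) (M : Fin (m + 1) → Matrix ι ι R) :
    (List.ofFn M).prod.trace = ∑ u : Fin (m + 1) → ι, ∏ i, M i (u i) (u (i + 1)) := by
  rw [Matrix.trace, ← (Fin.consEquiv fun _ => ι).sum_comp, Fintype.sum_prod_type]
  refine Finset.sum_congr rfl fun a _ => ?_
  rw [Matrix.diag_apply, prod_ofFn_apply]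
  refine Finset.sum_congr rfl fun u _ => Finset.prod_congr rfl fun i _ => ?_
  simp only [Fin.consEquiv_apply]
  congr 1
  refine Fin.lastCases ?_ (fun j => ?_) i
  · simp
  · rw [Fin.snoc_castSucc, Fin.coeSucc_eq_succ, Fin.cons_succ]

/-- The sum of the steps with letter `k` of a closed path. -/
def blockSum (e : ι → V) {m : ℕ} (f : Fin (m + 1) → K) (u : Fin (m + 1) → ι) (k : K) : V :=
  ∑ i with f i = k, (e (u (i + 1)) - e (u i))

open Classical in
/-- The closed paths whose block sums lie in the subgroups `Λ k`. -/
noncomputable def balancedPaths (e : ι → V) (Λ : K → AddSubgroup V) {m : ℕ}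
    (f : Fin (m + 1) → K) : Finset (Fin (m + 1) → ι) :=
  Finset.univ.filter fun u => ∀ k, blockSum e f u k ∈ Λ k

theorem mem_balancedPaths {m : ℕ} {f : Fin (m + 1) → K} {u : Fin (m + 1) → ι} :
    u ∈ balancedPaths e Λ f ↔ ∀ k, blockSum e f u k ∈ Λ k := by
  simp [balancedPaths]

theorem addChar_sum {α : Type*} (ψ : AddChar V ℂ) (s : Finset α) (g : α → V) :
    ψ (∑ i ∈ s, g i) = ∏ i ∈ s, ψ (g i) := by
  classical
  induction s using Finset.induction_on with
  | empty => simp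
  | insert a s ha ih => rw [Finset.sum_insert ha, Finset.prod_insert ha, AddChar.map_add_eq_mul, ih]

/-- Different letters are independent, so the average of each path factors into indicators that its
block sums lie in the `Λ k`. -/
theorem IsFourWise.norm_wordTrace_le (h : IsFourWise e χ Λ) {m : ℕ}
    (f : Fin (m + 1) → K) :
    ‖wordTrace e χ (List.ofFn f)‖ ≤ (balancedPaths e Λ f).card := by
  have h1 : ∀ ω : ∀ k, Ω k,
      ((List.ofFn f).map fun k => stepMatrix e (χ k (ω k))).prod.trace =
        ∑ u : Fin (m + 1) → ι, ∏ k, χ k (ω k) (blockSum e f u k) := by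
    intro ω
    rw [List.map_ofFn, trace_prod_ofFn]
    refine Finset.sum_congr rfl fun u _ => ?_
    rw [← Finset.prod_fiberwise (g := f)]
    refine Finset.prod_congr rfl fun k _ => ?_
    rw [blockSum, addChar_sum]
    refine Finset.prod_congr rfl fun i hi => ?_
    have hi := (Finset.mem_filter.1 hi).2
    subst hi
    rfl
  have h2 : ∑ ω : ∀ k, Ω k, ((List.ofFn f).map fun k => stepMatrix e (χ k (ω k))).prod.trace =
      (balancedPaths e Λ f).card * (Fintype.card (∀ k, Ω k) : ℂ) := by
    simp_rw [h1]
    rw [Finset.sum_comm]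
    have h3 : ∀ u : Fin (m + 1) → ι, ∑ ω : ∀ k, Ω k, ∏ k, χ k (ω k) (blockSum e f u k) =
        if u ∈ balancedPaths e Λ f then (Fintype.card (∀ k, Ω k) : ℂ) else 0 := by
      intro u
      rw [← Fintype.prod_sum fun k x => χ k x (blockSum e f u k)]
      split_ifs with hu
      · rw [mem_balancedPaths] at hu
        rw [Finset.prod_congr rfl fun k _ => h.mean k _ (hu k), Fintype.card_pi]
        push_cast; rfl
      · rw [mem_balancedPaths, not_forall] at hu
        obtain ⟨k, hk⟩ := hu
        exact Finset.prod_eq_zero (Finset.mem_univ k) (h.mean_zero k _ hk)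
    simp_rw [h3]
    simp
  rw [wordTrace, h2, norm_div, norm_mul, Complex.norm_natCast, Complex.norm_natCast]
  rcases eq_or_ne (Fintype.card (∀ k, Ω k) : ℝ) 0 with h0 | h0
  · rw [h0]; simp
  · rw [mul_div_cancel_right₀ _ h0]

/-- `i` is the last position of its letter in the word `f`. -/
def IsLast {m : ℕ} (f : Fin (m + 1) → K) (i : Fin (m + 1)) : Prop := ∀ j, i < j → f j ≠ f i

open Classical in
/-- The last positions of the letters of the word `f`. -/
noncomputable def lastPositions {m : ℕ} (f : Fin (m + 1) → K) : Finset (Fin (m + 1)) :=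
  Finset.univ.filter (IsLast f)

open Classical in
/-- The vertices of a path not entered by the last step of a letter. -/
noncomputable def freeVertices {m : ℕ} (f : Fin (m + 1) → K) : Finset (Fin (m + 1)) :=
  Finset.univ.filter fun x => ∀ i, IsLast f i → (i : ℕ) + 1 ≠ x

theorem mem_freeVertices {m : ℕ} {f : Fin (m + 1) → K} {x : Fin (m + 1)} :
    x ∈ freeVertices f ↔ ∀ i, IsLast f i → (i : ℕ) + 1 ≠ x := by
  simp [freeVertices]

theorem mem_lastPositions {m : ℕ} {f : Fin (m + 1) → K} {i : Fin (m + 1)} :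
    i ∈ lastPositions f ↔ IsLast f i := by
  simp [lastPositions]

theorem exists_isLast {m : ℕ} (f : Fin (m + 1) → K) (i : Fin (m + 1)) :
    ∃ j, f j = f i ∧ IsLast f j := by
  have hne : (Finset.univ.filter fun j => f j = f i).Nonempty := ⟨i, by simp⟩
  refine ⟨Finset.max' _ hne, ?_, ?_⟩
  · exact (Finset.mem_filter.1 (Finset.max'_mem _ hne)).2
  · intro k hk hfk
    have h1 := (Finset.mem_filter.1 (Finset.max'_mem _ hne)).2
    have := Finset.le_max' (Finset.univ.filter fun j => f j = f i) k (by simp [hfk, h1])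
    exact absurd hk (not_lt.2 this)

theorem isLast_last {m : ℕ} (f : Fin (m + 1) → K) : IsLast f (Fin.last m) :=
  fun j hj => absurd hj (not_lt.2 (Fin.le_last j))

theorem card_lastPositions {m : ℕ} (f : Fin (m + 1) → K) :
    (lastPositions f).card = (Finset.univ.image f).card := by
  have hi : Set.InjOn f (lastPositions f) := by
    intro i hi j hj hij
    simp only [lastPositions, Finset.coe_filter, Finset.mem_univ, true_and,
      Set.mem_ofPred_eq] at hi hj
    by_contra hne
    rcases lt_or_gt_of_ne hne with hlt | hlt
    · exact hi j hlt hij.symm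
    · exact hj i hlt hij
  rw [← Finset.card_image_of_injOn hi]
  congr 1
  ext k
  simp only [Finset.mem_image, Finset.mem_univ, true_and, lastPositions, Finset.mem_filter]
  constructor
  · rintro ⟨i, _, rfl⟩; exact ⟨i, rfl⟩
  · rintro ⟨i, rfl⟩
    obtain ⟨j, hj, hl⟩ := exists_isLast f i
    exact ⟨j, hl, hj⟩

theorem val_add_one_of_lt' {m : ℕ} {i j : Fin (m + 1)} (h : i < j) :
    ((i + 1 : Fin (m + 1)) : ℕ) = i + 1 :=
  Fin.val_add_one_of_lt (lt_of_lt_of_le h (Fin.le_last j))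

/-- Each letter excludes the endpoint of its last step, except the letter at position m: that step
returns to vertex 0, which stays free because `(i : ℕ) + 1` does not wrap. -/
theorem card_freeVertices {m : ℕ} (f : Fin (m + 1) → K) :
    (freeVertices f).card + (Finset.univ.image f).card = m + 2 := by
  rw [← card_lastPositions]
  have hlast : Fin.last m ∈ lastPositions f := by simp [lastPositions, isLast_last]
  have h1 : ((freeVertices f)ᶜ).card = ((lastPositions f).erase (Fin.last m)).card := by
    rw [← Finset.card_image_of_injective ((lastPositions f).erase (Fin.last m))
      (add_left_injective (1 : Fin (m + 1)))]
    congr 1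
    ext x
    simp only [Finset.mem_compl, mem_freeVertices, Finset.mem_image, Finset.mem_erase,
      lastPositions, Finset.mem_filter, Finset.mem_univ, true_and]
    push Not
    constructor
    · rintro ⟨i, hi, hix⟩
      have hlt : i < x := by rw [Fin.lt_def]; omega
      exact ⟨i, ⟨ne_of_lt (lt_of_lt_of_le hlt (Fin.le_last x)), hi⟩,
        Fin.ext (by rw [val_add_one_of_lt' hlt, hix])⟩
    · rintro ⟨i, ⟨hne, hi⟩, rfl⟩
      exact ⟨i, hi, (val_add_one_of_lt' (lt_of_le_of_ne (Fin.le_last i) hne)).symm⟩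
  rw [Finset.card_erase_of_mem hlast, Finset.card_compl, Fintype.card_fin] at h1
  have h2 := Finset.card_pos.2 ⟨_, hlast⟩
  have h3 := Finset.card_le_univ (freeVertices f)
  rw [Fintype.card_fin] at h3
  omega

theorem sub_blockSum_mem {m : ℕ} {f : Fin (m + 1) → K} {u u' : Fin (m + 1) → ι}
    (hu : u ∈ balancedPaths e Λ f) (hu' : u' ∈ balancedPaths e Λ f) (i : Fin (m + 1))
    (h : ∀ j, f j = f i → j ≠ i → e (u (j + 1)) - e (u j) = e (u' (j + 1)) - e (u' j)) :
    (e (u (i + 1)) - e (u i)) - (e (u' (i + 1)) - e (u' i)) ∈ Λ (f i) := by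
  rw [mem_balancedPaths] at hu hu'
  have h1 := (Λ (f i)).sub_mem (hu (f i)) (hu' (f i))
  rw [blockSum, blockSum, ← Finset.sum_sub_distrib, Finset.sum_eq_single i] at h1
  · exact h1
  · intro j hj hji
    rw [h j (Finset.mem_filter.1 hj).2 hji, sub_self]
  · simp

/-- At the last step of a letter all its other steps are known, so the block sum fixes this step
modulo `Λ` and thereby its endpoint. The set `A` holds vertices whose values are known for another
reason. -/
theorem IsFourWise.eq_of_eqOn_freeVertices (h : IsFourWise e χ Λ) {m : ℕ} {f : Fin (m + 1) → K}
    {u u' : Fin (m + 1) → ι} (hu : u ∈ balancedPaths e Λ f) (hu' : u' ∈ balancedPaths e Λ f)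
    (A : Finset (Fin (m + 1))) (hA : ∀ x ∈ freeVertices f, x ∉ A → u x = u' x)
    (hA' : ∀ x ∈ A, u x = u' x) : u = u' := by
  have key : ∀ N, ∀ x : Fin (m + 1), (x : ℕ) = N → u x = u' x := by
    intro N
    induction N using Nat.strong_induction_on with
    | _ N ih =>
      rintro x rfl
      by_cases hxA : x ∈ A
      · exact hA' x hxA
      by_cases hx : x ∈ freeVertices f
      · exact hA x hx hxA
      rw [mem_freeVertices] at hx
      push Not at hx
      obtain ⟨i, hi, hix⟩ := hx
      have hlt : i < x := by rw [Fin.lt_def]; omega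
      have hxi : i + 1 = x := Fin.ext (by rw [val_add_one_of_lt' hlt, hix])
      have h1 := sub_blockSum_mem hu hu' i fun j hj hji => by
        have hji' : j < i := lt_of_le_of_ne (not_lt.1 fun hl => hi j hl hj) hji
        rw [ih j (by rw [Fin.lt_def] at hji'; omega) j rfl,
          ih (j + 1 : Fin (m + 1)) (by rw [val_add_one_of_lt' hji']; rw [Fin.lt_def] at hji'; omega)
            _ rfl]
      rw [hxi, ih i (by omega) i rfl, sub_sub_sub_cancel_right] at h1
      exact h.eq_of_sub_mem _ _ _ h1
  exact funext fun x => key x x rfl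

end ClosedPaths

/-! ### Irreducible words lose a factor of the dimension. -/

section Irreducible

variable {K : Type*} [Fintype K] [DecidableEq K] {Ω : K → Type*} [∀ k, Fintype (Ω k)]
  {V : Type*} [AddCommGroup V] {ι : Type*} [Fintype ι] [DecidableEq ι]
  {e : ι → V} {χ : ∀ k, Ω k → AddChar V ℂ} {Λ : K → AddSubgroup V}

theorem card_image_restrict_le {α : Type*} [DecidableEq α] (S : Finset (α → ι)) (T : Finset α) :
    (S.image fun u (x : T) => u x).card ≤ Fintype.card ι ^ T.card := by
  refine (Finset.card_le_univ _).trans ?_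
  simp

/-- Free vertices determine the path, but there is one too many of them. Let k be the earliest last
position; all vertices up to k are free. Let j < k be another occurrence of its letter. If step k
moves, its class modulo `Λ` is fixed by free vertices other than k, and the four-wise condition
leaves two values for `u k`. If step k stays put, vertex j + 1 enters the block sum only through
step j, since equal letters are not adjacent, so its value is determined. The constant is 2 + 1. -/
theorem IsFourWise.card_balancedPaths_le (h : IsFourWise e χ Λ) {m : ℕ} (f : Fin (m + 1) → K)
    (hadj : ∀ i j : Fin (m + 1), (i : ℕ) + 1 = j → f i ≠ f j)
    (hsing : ∀ i, ∃ j, j ≠ i ∧ f j = f i) :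
    (balancedPaths e Λ f).card ≤
      3 * Fintype.card ι ^ (m + 1 - (Finset.univ.image f).card) := by
  have hne : (lastPositions f).Nonempty := ⟨Fin.last m, mem_lastPositions.2 (isLast_last f)⟩
  obtain ⟨k, hk, hmin⟩ : ∃ k, IsLast f k ∧ ∀ i, IsLast f i → k ≤ i :=
    ⟨(lastPositions f).min' hne, mem_lastPositions.1 (Finset.min'_mem _ hne),
      fun i hi => Finset.min'_le _ _ (mem_lastPositions.2 hi)⟩
  have hkm : k < Fin.last m := by
    obtain ⟨i, hi, -⟩ := hsing (Fin.last m)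
    have hi' := lt_of_le_of_ne (Fin.le_last i) hi
    rw [Fin.lt_def, Fin.val_last] at hi'
    -- The letter at m - 1 differs from the one at m, so its last occurrence comes before m.
    obtain ⟨j, hj, hjl⟩ := exists_isLast f ⟨m - 1, by omega⟩
    refine lt_of_le_of_lt (hmin j hjl) (lt_of_le_of_ne (Fin.le_last j) ?_)
    rintro rfl
    exact hadj ⟨m - 1, by omega⟩ (Fin.last m) (by simp only [Fin.val_last]; omega) hj.symm
  have hfree : ∀ x : Fin (m + 1), x ≤ k → x ∈ freeVertices f := by
    intro x hx
    rw [mem_freeVertices]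
    intro i hi hix
    have := hmin i hi
    rw [Fin.le_def] at this hx
    omega
  obtain ⟨j, hjk, hfj⟩ := hsing k
  have hjlt : j < k := lt_of_le_of_ne (not_lt.1 fun hl => hk j hl hfj) hjk
  have hkv := val_add_one_of_lt' hkm
  have hjv := val_add_one_of_lt' hjlt
  have hjk' : (j : ℕ) + 1 < k := by
    rw [Fin.lt_def] at hjlt
    exact lt_of_le_of_ne hjlt fun hE => hadj j k hE hfj
  have hlt : ∀ i, f i = f k → i ≠ k → (i : ℕ) + 1 < k ∧ ((i + 1 : Fin (m + 1)) : ℕ) = i + 1 := by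
    intro i hi hik
    have hil : i < k := lt_of_le_of_ne (not_lt.1 fun hl => hk i hl hi) hik
    refine ⟨?_, val_add_one_of_lt' hil⟩
    rw [Fin.lt_def] at hil
    exact lt_of_le_of_ne hil fun hE => hadj i k hE hi
  have hcard := card_freeVertices f
  have herase : ∀ x, x ≤ k → Fintype.card ι ^ ((freeVertices f).erase x).card =
      Fintype.card ι ^ (m + 1 - (Finset.univ.image f).card) := by
    intro x hx
    rw [Finset.card_erase_of_mem (hfree x hx)]
    congr 1; omega
  have hfull : ∀ u ∈ balancedPaths e Λ f, ∀ u' ∈ balancedPaths e Λ f, ∀ x,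
      (∀ y ∈ freeVertices f, y ≠ x → u y = u' y) → u x = u' x → u = u' := by
    intro u hu u' hu' x h1 h2
    refine h.eq_of_eqOn_freeVertices hu hu' {x} (fun y hy hyx => h1 y hy (by simpa using hyx)) ?_
    simpa using h2
  set S := balancedPaths e Λ f with hS
  have hS1 : (S.filter fun u => ¬ u (k + 1) = u k).card ≤
      2 * Fintype.card ι ^ (m + 1 - (Finset.univ.image f).card) := by
    have hfib := Finset.card_le_mul_card_image
      (f := fun (u : Fin (m + 1) → ι) (x : (freeVertices f).erase k) => u x)
      (S.filter fun u => ¬ u (k + 1) = u k) 2 ?_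
    · refine hfib.trans (Nat.mul_le_mul_left 2 ?_)
      rw [← herase k le_rfl]
      exact card_image_restrict_le _ _
    · intro a ha
      obtain ⟨u, hu, rfl⟩ := Finset.mem_image.1 ha
      have hu := Finset.mem_filter.1 hu
      refine le_trans (Finset.card_le_card_of_injOn (t := {u (k + 1), u k}) (fun v => v k)
        ?_ ?_) Finset.card_le_two
      · intro v hv
        have hv := Finset.mem_filter.1 hv
        have hvS := Finset.mem_filter.1 hv.1
        have hag : ∀ y ∈ freeVertices f, y ≠ k → u y = v y := fun y hy hyk =>
          (congrFun hv.2 ⟨y, Finset.mem_erase.2 ⟨hyk, hy⟩⟩).symm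
        have hmem := sub_blockSum_mem hu.1 hvS.1 k fun i hi hik => by
          obtain ⟨h1, h2⟩ := hlt i hi hik
          rw [hag i (hfree i (by rw [Fin.le_def]; omega)) hik,
            hag (i + 1) (hfree _ (by rw [Fin.le_def]; omega))
              (fun hE => by rw [Fin.ext_iff] at hE; omega)]
        have := h.eq_or_eq_of_sub_mem _ _ _ _ _ hu.2 hvS.2 hmem
        simp only [Finset.coe_insert, Finset.coe_singleton, Set.mem_insert_iff,
          Set.mem_singleton_iff]
        exact this.symm
      · intro v hv v' hv' hvv
        have hv := Finset.mem_filter.1 hv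
        have hv' := Finset.mem_filter.1 hv'
        exact hfull v (Finset.mem_filter.1 hv.1).1 v' (Finset.mem_filter.1 hv'.1).1 k
          (fun y hy hyk => congrFun (hv.2.trans hv'.2.symm) ⟨y, Finset.mem_erase.2 ⟨hyk, hy⟩⟩) hvv
  have hS2 : (S.filter fun u => u (k + 1) = u k).card ≤
      Fintype.card ι ^ (m + 1 - (Finset.univ.image f).card) := by
    have hj1 : j + 1 ≤ k := by rw [Fin.le_def]; omega
    rw [← herase (j + 1) hj1, ← Finset.card_image_of_injOn
      (f := fun (u : Fin (m + 1) → ι) (x : (freeVertices f).erase (j + 1)) => u x)]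
    · exact card_image_restrict_le _ _
    · intro u hu v hv huv
      have hu := Finset.mem_filter.1 hu
      have hv := Finset.mem_filter.1 hv
      have hag : ∀ y ∈ freeVertices f, y ≠ j + 1 → u y = v y := fun y hy hyj =>
        congrFun huv ⟨y, Finset.mem_erase.2 ⟨hyj, hy⟩⟩
      refine hfull u hu.1 v hv.1 (j + 1) hag ?_
      have hmem := sub_blockSum_mem hu.1 hv.1 j fun i hi hij => by
        by_cases hik : i = k
        · rw [hik, hu.2, hv.2, sub_self, sub_self]
        · obtain ⟨h1, h2⟩ := hlt i (hi.trans hfj) hik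
          rw [hag i (hfree i (by rw [Fin.le_def]; omega)) fun hE => ?_,
            hag (i + 1) (hfree _ (by rw [Fin.le_def]; omega)) fun hE => ?_]
          · rw [Fin.ext_iff, h2, hjv] at hE
            exact hij (Fin.ext (by omega))
          · exact hadj j i (by rw [hE, hjv]) hi.symm
      rw [hag j (hfree j hjlt.le) fun hE => by rw [Fin.ext_iff] at hE; omega,
        sub_sub_sub_cancel_right] at hmem
      exact h.eq_of_sub_mem _ _ _ hmem
  have := Finset.card_filter_add_card_filter_not (s := S) (fun u => u (k + 1) = u k)
  omega

theorem exists_adjacent_or_single_or_irreducible (w : List K) :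
    w = [] ∨ (∃ u a v, w = u ++ a :: a :: v) ∨ (∃ u a v, w = u ++ a :: v ∧ a ∉ u ∧ a ∉ v) ∨
      ∃ (m : ℕ) (f : Fin (m + 1) → K), w = List.ofFn f ∧
        (∀ i j : Fin (m + 1), (i : ℕ) + 1 = j → f i ≠ f j) ∧ ∀ i, ∃ j, j ≠ i ∧ f j = f i := by
  rcases hw : w.length with _ | m
  · exact Or.inl (List.length_eq_zero_iff.1 hw)
  right
  by_contra! hcon
  obtain ⟨h1, h2, h3⟩ := hcon
  obtain ⟨f, rfl⟩ : ∃ f : Fin (m + 1) → K, w = List.ofFn f := by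
    rw [← hw]; exact ⟨w.get, (List.ofFn_get w).symm⟩
  have hget : ∀ i : Fin (m + 1), (List.ofFn f)[(i : ℕ)]'(by
      rw [List.length_ofFn]; exact i.2) = f i := fun i => by rw [List.getElem_ofFn]
  have hsplit : ∀ i : Fin (m + 1), List.ofFn f =
      (List.ofFn f).take i ++ f i :: (List.ofFn f).drop (i + 1) := by
    intro i
    rw [← hget i, ← List.drop_eq_getElem_cons, List.take_append_drop]
  obtain ⟨i, hi⟩ := h3 m f rfl fun i j hij hf => by
    apply h1 ((List.ofFn f).take i) (f i) ((List.ofFn f).drop (j + 1))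
    have hd : (List.ofFn f).drop (i + 1) = f j :: (List.ofFn f).drop (j + 1) := by
      rw [← hget j, hij, ← List.drop_eq_getElem_cons]
    conv_lhs => rw [hsplit i, hd, ← hf]
  refine absurd (h2 _ _ _ (hsplit i) ?_) ?_
  · intro hm
    obtain ⟨j, hj, hjm⟩ := List.mem_take_iff_getElem.1 hm
    have hj' : j < i ∧ j < m + 1 := by
      rwa [List.length_ofFn, lt_min_iff] at hj
    rw [List.getElem_ofFn] at hjm
    refine hi ⟨j, hj'.2⟩ (fun hE => ?_) hjm
    rw [Fin.ext_iff] at hE; simp only at hE; omega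
  · intro hm
    obtain ⟨j, hj, hjm⟩ := List.mem_drop_iff_getElem.1 hm
    have hj' : j + (i + 1) < m + 1 := by
      rwa [List.length_ofFn] at hj
    rw [List.getElem_ofFn] at hjm
    refine hi ⟨i + 1 + j, by omega⟩ (fun hE => ?_) hjm
    rw [Fin.ext_iff] at hE; simp only at hE; omega

/-- Deleting a single letter preserves the exponent. Merging a pair lowers it by one, which the
extracted factor compensates. So the bound spreads from irreducible words to all words that are not
accepted. -/
theorem IsFourWise.norm_wordTrace_le_of_not_accepts [∀ k, Nonempty (Ω k)]
    (h : IsFourWise e χ Λ) (w : List K) (hw : ¬ stackAccepts [] ∅ w) :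
    ‖wordTrace e χ w‖ ≤ 3 * (Fintype.card ι : ℝ) ^ (w.length - w.toFinset.card) := by
  induction hL : w.length using Nat.strong_induction_on generalizing w with
  | _ L ih =>
    subst hL
    rcases exists_adjacent_or_single_or_irreducible w with
      rfl | ⟨u, a, v, rfl⟩ | ⟨u, a, v, rfl, hu, hv⟩ | ⟨m, f, rfl, h1, h2⟩
    · exact absurd (stackAccepts_nil _ _) hw
    · have h1 := ih _ (by simp) (u ++ a :: v) (fun h' => hw (stackAccepts_double h')) rfl
      have h2 : (u ++ a :: a :: v).toFinset = (u ++ a :: v).toFinset := by ext; simp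
      have h3 := List.toFinset_card_le (u ++ a :: v)
      rw [h2, show (u ++ a :: a :: v).length = (u ++ a :: v).length + 1 by simp [add_assoc],
        Nat.succ_sub h3, pow_succ, wordTrace_double, norm_mul, Complex.norm_natCast]
      nlinarith [h1, (Nat.cast_nonneg (Fintype.card ι) : (0 : ℝ) ≤ _)]
    · have h1 := ih _ (by simp) (u ++ v)
        (fun h' => hw (stackAccepts_insert h' hu hv (by simp) (by simp))) rfl
      have h2 : (u ++ a :: v).toFinset = insert a (u ++ v).toFinset := by ext; simp
      rw [h.wordTrace_insert hu hv, h2, Finset.card_insert_of_notMem (by simp [hu, hv]),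
        show (u ++ a :: v).length = (u ++ v).length + 1 by simp [add_assoc], Nat.add_sub_add_right]
      exact h1
    · have h3 := h.card_balancedPaths_le f h1 h2
      have h4 : (List.ofFn f).toFinset = Finset.univ.image f := by
        ext
        simp only [List.mem_toFinset, List.mem_ofFn, Finset.mem_image, Finset.mem_univ, true_and]
      refine (h.norm_wordTrace_le f).trans ?_
      rw [h4, List.length_ofFn]
      exact_mod_cast h3

theorem IsFourWise.norm_wordTrace_sub_le [∀ k, Nonempty (Ω k)]
    (h : IsFourWise e χ Λ) (w : List K) :
    ‖wordTrace e χ w - Fintype.card ι * (stackWeight (Fintype.card ι : ℝ) [] ∅ w : ℂ)‖ ≤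
      3 * (Fintype.card ι : ℝ) ^ (w.length - w.toFinset.card) := by
  by_cases hw : stackAccepts [] ∅ w
  · have := h.wordTrace_of_accepts List.nodup_nil hw
    rw [List.reverse_nil, List.nil_append] at this
    rw [this, sub_self, norm_zero]
    positivity
  · rw [stackWeight_of_not_accepts _ hw]
    simpa using h.norm_wordTrace_le_of_not_accepts w hw

end Irreducible

/-! ### Sums of weights over alternating words. -/

section AlternatingWords

variable {K : Type*} [Fintype K] [DecidableEq K] (ty : K → Bool)

/-- The words of length `m` whose letters have alternating types, the first being `t`. -/
def altWords : Bool → ℕ → Finset (List K)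
  | _, 0 => {[]}
  | t, m + 1 => ((Finset.univ.filter fun k => ty k = t) ×ˢ altWords (!t) m).image
      fun z => z.1 :: z.2

/-- The product `c t * c (!t) * c t * ⋯` with `m` factors. -/
def altProd (c : Bool → ℝ) : Bool → ℕ → ℝ
  | _, 0 => 1
  | t, m + 1 => c t * altProd c (!t) m

theorem altProd_true_two_mul (c : Bool → ℝ) (l : ℕ) :
    altProd c true (2 * l) = (c true * c false) ^ l := by
  induction l with
  | zero => simp [altProd]
  | succ l ih => rw [Nat.mul_succ, altProd, altProd, Bool.not_true, Bool.not_false, ih]; ring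

theorem altProd_nonneg {c : Bool → ℝ} (hc : ∀ t, 0 ≤ c t) (t : Bool) (m : ℕ) :
    0 ≤ altProd c t m := by
  induction m generalizing t with
  | zero => simp [altProd]
  | succ m ih => exact mul_nonneg (hc t) (ih _)

theorem sum_altWords_succ {R : Type*} [AddCommMonoid R] (t : Bool) (m : ℕ) (g : List K → R) :
    ∑ w ∈ altWords ty t (m + 1), g w =
      ∑ k with ty k = t, ∑ w ∈ altWords ty (!t) m, g (k :: w) := by
  rw [altWords, Finset.sum_image, Finset.sum_product]
  rintro ⟨a, u⟩ _ ⟨b, v⟩ _ h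
  simpa using h

theorem sum_altWords_prod {R : Type*} [Semiring R] (D : K → R) (l : ℕ) :
    ∑ w ∈ altWords ty true (2 * l), (w.map D).prod =
      ((∑ k with ty k = true, D k) * ∑ k with ty k = false, D k) ^ l := by
  induction l with
  | zero => simp [altWords]
  | succ l ih =>
    rw [Nat.mul_succ, sum_altWords_succ, pow_succ', ← ih]
    simp only [sum_altWords_succ, Bool.not_true, Bool.not_false, List.map_cons, List.prod_cons,
      ← mul_assoc]
    simp only [← Finset.mul_sum, ← Finset.sum_mul]

variable {ty}

theorem card_letters_le {t : Bool} {m : ℕ} {w : List K} (hw : w ∈ altWords ty t m) :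
    (w.toFinset.filter (ty · = t)).card ≤ (m + 1) / 2 ∧
      (w.toFinset.filter (ty · = !t)).card ≤ m / 2 := by
  induction m generalizing t w with
  | zero => simp_all [altWords]
  | succ m ih =>
    rw [altWords, Finset.mem_image] at hw
    obtain ⟨⟨a, u⟩, h, rfl⟩ := hw
    rw [Finset.mem_product, Finset.mem_filter] at h
    have h1 := ih (w := u) h.2
    rw [Bool.not_not] at h1
    have ha : ty a = t := h.1.2
    simp only [List.toFinset_cons]
    rw [Finset.filter_insert, if_pos ha, Finset.filter_insert, if_neg (by simp [ha])]
    have h2 := Finset.card_insert_le a (u.toFinset.filter (ty · = t))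
    omega

/-- A letter put in front is either new, or one of at most r letters of its type already used, and
then the exponent grows by one. -/
theorem sum_altWords_pow_le (N : ℝ) (hN : 0 ≤ N) (r : ℕ) (t : Bool) (m : ℕ)
    (hm : m ≤ 2 * (r + 1)) :
    ∑ w ∈ altWords ty t m, N ^ (w.length - w.toFinset.card) ≤
      altProd (fun t => ((Finset.univ.filter fun k => ty k = t).card : ℝ) + r * N) t m := by
  induction m generalizing t with
  | zero => simp [altWords, altProd]
  | succ m ih =>
    rw [sum_altWords_succ, altProd, Finset.sum_comm]
    refine le_trans ?_ (mul_le_mul_of_nonneg_left (ih (!t) (by omega)) (by positivity))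
    rw [Finset.mul_sum]
    refine Finset.sum_le_sum fun w hw => ?_
    have h1 : ∀ k, N ^ ((k :: w).length - (k :: w).toFinset.card) ≤
        (1 + if k ∈ w then N else 0) * N ^ (w.length - w.toFinset.card) := by
      intro k
      rw [List.toFinset_cons, List.length_cons]
      have h0 : 0 ≤ N ^ (w.length - w.toFinset.card) := by positivity
      split_ifs with hk
      · rw [Finset.insert_eq_of_mem (by simpa using hk), Nat.succ_sub (List.toFinset_card_le w),
          pow_succ]
        nlinarith
      · rw [Finset.card_insert_of_notMem (by simpa using hk), Nat.add_sub_add_right]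
        simp
    refine (Finset.sum_le_sum fun k _ => h1 k).trans ?_
    rw [← Finset.sum_mul]
    refine mul_le_mul_of_nonneg_right ?_ (by positivity)
    rw [Finset.sum_add_distrib, Finset.sum_const, nsmul_eq_mul, mul_one,
      ← Finset.sum_filter, Finset.sum_const, nsmul_eq_mul]
    have h2 : ((Finset.univ.filter fun k => ty k = t).filter (· ∈ w)).card ≤ r := by
      have h3 := (card_letters_le hw).2
      rw [Bool.not_not] at h3
      refine le_trans (Finset.card_le_card ?_) (h3.trans (by omega))
      intro k; simp; tauto
    have h3 : (((Finset.univ.filter fun k => ty k = t).filter (· ∈ w)).card : ℝ) ≤ r := by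
      exact_mod_cast h2
    nlinarith

theorem suffixSum_nonneg {α : Type*} {q : α → Prop} [DecidablePred q] {f : List α → ℝ}
    (hf : ∀ S, 0 ≤ f S) (S : List α) : 0 ≤ suffixSum q f S := by
  induction S with
  | nil => simp [suffixSum]
  | cons s S ih => rw [suffixSum]; split_ifs <;> linarith [hf (s :: S)]

theorem stackSum_nonneg {y : Bool → ℝ} (hy : ∀ t, 0 ≤ y t) (t : Bool) (m : ℕ) (S : List Bool) :
    0 ≤ stackSum y t m S := by
  induction m generalizing t S with
  | zero => simp [stackSum]
  | succ m ih =>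
    rw [stackSum]
    exact add_nonneg (ih _ _) (mul_nonneg (hy t) (suffixSum_nonneg (fun _ => ih _ _) S))

theorem suffixSum_le {f : List Bool → ℝ} {t : Bool} {B : ℝ} {S : List Bool}
    (hf : ∀ T, T <:+ S → f T ≤ B) : suffixSum (· = t) f S ≤ S.count t * B := by
  induction S with
  | nil => simp [suffixSum]
  | cons s S ih =>
    have h1 := ih fun T hT => hf T (hT.trans (List.suffix_cons s S))
    rw [suffixSum]
    split_ifs with h
    · subst h
      rw [List.count_cons_self]
      push_cast
      linarith [hf _ List.suffix_rfl]
    · rw [List.count_cons_of_ne h]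
      linarith

/-- Each letter is pushed or meets one of at most r stack letters of its type, giving a factor of at
most 1 + r y. -/
theorem stackSum_le {y : Bool → ℝ} (hy : ∀ t, 0 ≤ y t) (r : ℕ) (t : Bool) (m : ℕ)
    (S : List Bool) (h1 : S.count t + (m + 1) / 2 ≤ r + 1)
    (h2 : S.count (!t) + m / 2 ≤ r + 1) :
    stackSum y t m S ≤ altProd (fun t => 1 + r * y t) t m := by
  induction m generalizing t S with
  | zero => simp [stackSum, altProd]
  | succ m ih =>
    have hB : 0 ≤ altProd (fun t => 1 + r * y t) (!t) m :=
      altProd_nonneg (fun t => by have := hy t; positivity) _ _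
    have h3 : suffixSum (· = t) (stackSum y (!t) m) S ≤
        S.count t * altProd (fun t => 1 + r * y t) (!t) m := by
      refine suffixSum_le fun T hT => ih _ _ ?_ ?_
      · have := hT.sublist.count_le (!t); omega
      · have := hT.sublist.count_le t
        rw [Bool.not_not]; omega
    have h4 : (S.count t : ℝ) ≤ r := by exact_mod_cast (by omega : S.count t ≤ r)
    have h5 := ih (!t) (t :: S) (by rw [List.count_cons_of_ne (by simp)]; omega)
      (by rw [Bool.not_not, List.count_cons_self]; omega)
    rw [stackSum, altProd]
    calc _ ≤ altProd (fun t => 1 + r * y t) (!t) m +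
          y t * (r * altProd (fun t => 1 + r * y t) (!t) m) :=
        add_le_add h5 (mul_le_mul_of_nonneg_left
          (h3.trans (mul_le_mul_of_nonneg_right h4 hB)) (hy t))
      _ = _ := by ring

theorem sum_dropWhile_eq_suffixSum {S : List K} (hS : S.Nodup) (t : Bool) (G : List Bool → ℝ) :
    ∑ k ∈ S.toFinset with ty k = t, G ((S.dropWhile (· ≠ k)).map ty) =
      suffixSum (· = t) G (S.map ty) := by
  induction S with
  | nil => simp [suffixSum]
  | cons s S ih =>
    rw [List.nodup_cons] at hS
    rw [List.map_cons, suffixSum, ← ih hS.2, List.toFinset_cons, Finset.sum_filter,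
      Finset.sum_insert (by simpa using hS.1), Finset.sum_filter]
    congr 1
    · simp
    · refine Finset.sum_congr rfl fun k hk => ?_
      have : s ≠ k := fun h => hS.1 (by rw [h]; simpa using hk)
      simp [this]

variable {N : ℝ} {x y : Bool → ℝ}

theorem stackWeight_nonneg (hN : 0 ≤ N) (S : List K) (D : Finset K) (w : List K) :
    0 ≤ stackWeight N S D w := by
  induction w generalizing S D with
  | nil => simp [stackWeight]
  | cons a w ih =>
    rw [stackWeight]
    split_ifs
    · exact le_rfl
    · exact mul_nonneg hN (ih _ _)
    · exact ih _ _

/-- Since N = x y, pushes and matches both carry a factor x. Pushes are overcounted by allowing all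
x letters of the type. -/
theorem sum_stackWeight_le (hN : 0 ≤ N) (hy : ∀ t, 0 ≤ y t)
    (hx : ∀ t, x t = (Finset.univ.filter fun k => ty k = t).card) (hxy : ∀ t, x t * y t = N)
    (t : Bool) (m : ℕ) {S : List K} (hS : S.Nodup) (D : Finset K) :
    ∑ w ∈ altWords ty t m, stackWeight N S D w ≤
      altProd x t m * stackSum y t m (S.map ty) := by
  induction m generalizing t S D with
  | zero => simp [altWords, stackWeight, altProd, stackSum]
  | succ m ih =>
    have hx0 : ∀ t, 0 ≤ x t := fun t => by rw [hx]; positivity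
    have hX : 0 ≤ altProd x (!t) m := altProd_nonneg hx0 _ _
    have h1 : ∀ k, ty k = t → ∑ w ∈ altWords ty (!t) m, stackWeight N S D (k :: w) ≤
        altProd x (!t) m * stackSum y (!t) m (t :: S.map ty) + if k ∈ S then
          N * altProd x (!t) m * stackSum y (!t) m ((S.dropWhile (· ≠ k)).map ty) else 0 := by
      intro k hk
      have hv := stackSum_nonneg hy (!t) m (t :: S.map ty)
      have hv' := stackSum_nonneg hy (!t) m ((S.dropWhile (· ≠ k)).map ty)
      simp only [stackWeight]
      by_cases hD : k ∈ D
      · simp only [if_pos hD, Finset.sum_const_zero]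
        split_ifs <;> positivity
      by_cases hkS : k ∈ S
      · simp only [if_neg hD, if_pos hkS, ← Finset.mul_sum]
        have := mul_le_mul_of_nonneg_left (ih (!t) (S := S.dropWhile (· ≠ k))
          (hS.sublist (List.dropWhile_sublist _)) (D ∪ (S.takeWhile (· ≠ k)).toFinset)) hN
        nlinarith [mul_nonneg hX hv]
      · simp only [if_neg hD, if_neg hkS, add_zero]
        have := ih (!t) (List.nodup_cons.2 ⟨hkS, hS⟩) D
        rwa [List.map_cons, hk] at this
    rw [sum_altWords_succ]
    refine (Finset.sum_le_sum fun k hk => h1 k (Finset.mem_filter.1 hk).2).trans (le_of_eq ?_)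
    rw [Finset.sum_add_distrib, Finset.sum_const, nsmul_eq_mul, ← hx, stackSum, altProd,
      ← sum_dropWhile_eq_suffixSum hS, ← Finset.sum_filter, Finset.filter_filter, ← hxy t]
    have h2 : (Finset.univ.filter fun k => ty k = t ∧ k ∈ S) =
        S.toFinset.filter (ty · = t) := by ext; simp [and_comm]
    rw [h2, ← Finset.mul_sum]
    ring

/-- At most l letters of a type are in the stack or forbidden, so a push retains at least the
fraction γ of its choices. A match loses none and leaves the set of used letters unchanged. -/
theorem le_sum_stackWeight (hN : 0 ≤ N) (hy : ∀ t, 0 ≤ y t)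
    (hx : ∀ t, x t = (Finset.univ.filter fun k => ty k = t).card) (hxy : ∀ t, x t * y t = N)
    {γ : ℝ} (hγ0 : 0 ≤ γ) (hγ1 : γ ≤ 1) {l : ℕ} (hγ : ∀ t, γ * x t ≤ x t - l)
    (t : Bool) (m : ℕ) {S : List K} (hS : S.Nodup) {D : Finset K} (hSD : ∀ k ∈ S, k ∉ D)
    (h1 : ((S.toFinset ∪ D).filter (ty · = t)).card + (m + 1) / 2 ≤ l)
    (h2 : ((S.toFinset ∪ D).filter (ty · = !t)).card + m / 2 ≤ l) :
    γ ^ m * (altProd x t m * stackSum y t m (S.map ty)) ≤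
      ∑ w ∈ altWords ty t m, stackWeight N S D w := by
  induction m generalizing t S D with
  | zero => simp [altWords, stackWeight, altProd, stackSum]
  | succ m ih =>
    have hx0 : ∀ t, 0 ≤ x t := fun t => by rw [hx]; positivity
    have hX : 0 ≤ altProd x (!t) m := altProd_nonneg hx0 _ _
    have hv := stackSum_nonneg hy (!t) m (t :: S.map ty)
    have hγm : 0 ≤ γ ^ m := by positivity
    set U := S.toFinset ∪ D with hU
    have h3 : ∀ k, ty k = t → k ∉ U →
        γ ^ m * (altProd x (!t) m * stackSum y (!t) m (t :: S.map ty)) ≤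
          ∑ w ∈ altWords ty (!t) m, stackWeight N S D (k :: w) := by
      intro k hk hkU
      simp only [hU, Finset.mem_union, List.mem_toFinset, not_or] at hkU
      simp only [stackWeight, if_neg hkU.1, if_neg hkU.2]
      have hins : (k :: S).toFinset ∪ D = insert k U := by
        rw [List.toFinset_cons, Finset.insert_union]
      have := ih (!t) (List.nodup_cons.2 ⟨hkU.1, hS⟩) (D := D) ?_ ?_ ?_
      · rwa [List.map_cons, hk] at this
      · intro b hb
        rcases List.mem_cons.1 hb with rfl | hb
        · exact hkU.2
        · exact hSD b hb
      · rw [hins, Finset.filter_insert, if_neg (by simp [hk])]; omega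
      · rw [hins, Bool.not_not, Finset.filter_insert, if_pos hk]
        have := Finset.card_insert_le k (U.filter (ty · = t))
        omega
    have h4 : ∀ k ∈ S, ty k = t →
        N * (γ ^ m * altProd x (!t) m) * stackSum y (!t) m ((S.dropWhile (· ≠ k)).map ty) ≤
          ∑ w ∈ altWords ty (!t) m, stackWeight N S D (k :: w) := by
      intro k hkS hk
      simp only [stackWeight, if_neg (hSD k hkS), if_pos hkS, ← Finset.mul_sum]
      obtain ⟨T, S', hTS, hkT⟩ := List.eq_append_cons_of_mem hkS
      rw [mul_assoc, mul_assoc]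
      refine mul_le_mul_of_nonneg_left ?_ hN
      have hset : (S.dropWhile (· ≠ k)).toFinset ∪ (D ∪ (S.takeWhile (· ≠ k)).toFinset) = U := by
        rw [hU, hTS, dropWhile_ne_append hkT, takeWhile_ne_append hkT]
        ext; simp; tauto
      refine ih (!t) (hS.sublist (List.dropWhile_sublist _)) ?_ ?_ ?_
      · intro b hb
        have hbS : b ∈ S := (List.dropWhile_sublist _).subset hb
        rw [hTS] at hS
        rw [hTS, dropWhile_ne_append hkT] at hb
        rw [hTS, takeWhile_ne_append hkT, Finset.mem_union, not_or, List.mem_toFinset]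
        exact ⟨hSD b hbS, fun hbT => (List.nodup_append.1 hS).2.2 b hbT b hb rfl⟩
      · rw [hset]; omega
      · rw [hset, Bool.not_not]; omega
    rw [sum_altWords_succ]
    have hsplit : (Finset.univ.filter fun k => ty k = t) ⊇
        (S.toFinset.filter (ty · = t)) ∪ (Uᶜ.filter (ty · = t)) := by
      intro k; simp; tauto
    have hdisj : Disjoint (S.toFinset.filter (ty · = t)) (Uᶜ.filter (ty · = t)) := by
      rw [Finset.disjoint_left]
      intro k hk hk'
      simp only [hU, Finset.mem_filter, Finset.mem_compl, Finset.mem_union] at hk hk'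
      tauto
    refine le_trans ?_ (Finset.sum_le_sum_of_subset_of_nonneg hsplit fun k _ _ =>
      Finset.sum_nonneg fun w _ => stackWeight_nonneg hN _ _ _)
    rw [Finset.sum_union hdisj]
    have h5 := Finset.sum_le_sum fun k (hk : k ∈ S.toFinset.filter (ty · = t)) =>
      h4 k (by simpa using (Finset.mem_filter.1 hk).1) (Finset.mem_filter.1 hk).2
    have h6 := Finset.sum_le_sum fun k (hk : k ∈ Uᶜ.filter (ty · = t)) =>
      h3 k (Finset.mem_filter.1 hk).2 (by simpa using (Finset.mem_filter.1 hk).1)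
    rw [← Finset.mul_sum, sum_dropWhile_eq_suffixSum hS] at h5
    rw [Finset.sum_const, nsmul_eq_mul] at h6
    have hcard : x t - l ≤ ((Uᶜ.filter (ty · = t)).card : ℝ) := by
      have h7 : (Finset.univ.filter fun k => ty k = t).card =
          (U.filter (ty · = t)).card + (Uᶜ.filter (ty · = t)).card := by
        rw [← Finset.card_union_of_disjoint, ← Finset.filter_union, Finset.union_compl]
        exact Finset.disjoint_filter_filter disjoint_compl_right
      have h8 : (U.filter (ty · = t)).card ≤ l := by omega
      rw [hx, h7]
      push_cast
      have : ((U.filter (ty · = t)).card : ℝ) ≤ l := by exact_mod_cast h8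
      linarith
    have hs := suffixSum_nonneg (q := (· = t)) (stackSum_nonneg hy (!t) m) (S.map ty)
    rw [stackSum, altProd]
    set A := altProd x (!t) m
    set v := stackSum y (!t) m (t :: S.map ty)
    set s := suffixSum (· = t) (stackSum y (!t) m) (S.map ty)
    have h7 : (γ * x t) * (γ ^ m * (A * v)) ≤
        ((Uᶜ.filter (ty · = t)).card : ℝ) * (γ ^ m * (A * v)) :=
      mul_le_mul_of_nonneg_right ((hγ t).trans hcard) (by positivity)
    have h8 : γ * (N * (γ ^ m * A) * s) ≤ N * (γ ^ m * A) * s :=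
      mul_le_of_le_one_left (by positivity) hγ1
    calc γ ^ (m + 1) * (x t * A * (v + y t * s))
        = γ * (x t * y t * (γ ^ m * A) * s) + (γ * x t) * (γ ^ m * (A * v)) := by ring
      _ = γ * (N * (γ ^ m * A) * s) + (γ * x t) * (γ ^ m * (A * v)) := by rw [hxy t]
      _ ≤ _ := add_le_add (h8.trans h5) (h7.trans h6)

end AlternatingWords

/-! ### The sum of averaged traces against its main term. -/

section MeanTrace

variable {K : Type*} [Fintype K] [DecidableEq K] {Ω : K → Type*} [∀ k, Fintype (Ω k)]
  {V : Type*} [AddCommGroup V] {ι : Type*} [Fintype ι] [DecidableEq ι]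
  {e : ι → V} {χ : ∀ k, Ω k → AddChar V ℂ} {Λ : K → AddSubgroup V}

/-- The 3 pays for words that are not accepted, the other term for the shortage of new letters. Both
are measured against the same product, because 1 + (l - 1) y ≤ l Y. -/
theorem IsFourWise.norm_sum_wordTrace_sub_le [∀ k, Nonempty (Ω k)] (h : IsFourWise e χ Λ)
    (ty : K → Bool) {x y Y : Bool → ℝ} (hy : ∀ t, 0 ≤ y t)
    (hx : ∀ t, x t = (Finset.univ.filter fun k => ty k = t).card)
    (hxy : ∀ t, x t * y t = Fintype.card ι) (hY : ∀ t, 1 ≤ Y t) (hyY : ∀ t, y t ≤ Y t)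
    {l : ℕ} (hl : 1 ≤ l) {μ : ℝ} (hμ : ∀ t, μ ≤ x t) (hlμ : (l : ℝ) ≤ μ) :
    ‖∑ w ∈ altWords ty true (2 * l), wordTrace e χ w -
        ((Fintype.card ι * ((x true * x false) ^ l * stackSum y true (2 * l) []) : ℝ) : ℂ)‖ ≤
      (3 + 2 * l * (l / μ) * Fintype.card ι) *
        ((x true * x false) ^ l * ((l * Y true) * (l * Y false)) ^ l) := by
  set N : ℝ := ((Fintype.card ι : ℕ) : ℝ) with hN
  have hN0 : 0 ≤ N := by positivity
  obtain ⟨r, rfl⟩ : ∃ r, l = r + 1 := ⟨l - 1, by omega⟩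
  have hl0 : (0 : ℝ) < ((r + 1 : ℕ) : ℝ) := by positivity
  have hμ0 : 0 < μ := hl0.trans_le hlμ
  have hx0 : ∀ t, 0 ≤ x t := fun t => (hμ0.trans_le (hμ t)).le
  have hc : ∀ t, 1 + r * y t ≤ ((r + 1 : ℕ) : ℝ) * Y t := fun t => by
    push_cast
    nlinarith [hy t, hY t, hyY t, (Nat.cast_nonneg r : (0 : ℝ) ≤ r)]
  have hc0 : ∀ t, 0 ≤ 1 + r * y t := fun t => by have := hy t; positivity
  have hprod : ((1 + r * y true) * (1 + r * y false)) ^ (r + 1) ≤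
      ((((r + 1 : ℕ) : ℝ) * Y true) * (((r + 1 : ℕ) : ℝ) * Y false)) ^ (r + 1) :=
    pow_le_pow_left₀ (mul_nonneg (hc0 _) (hc0 _))
      (mul_le_mul (hc _) (hc _) (hc0 _) ((hc0 _).trans (hc _))) _
  set P := ((((r + 1 : ℕ) : ℝ) * Y true) * (((r + 1 : ℕ) : ℝ) * Y false)) ^ (r + 1)
  set X := (x true * x false) ^ (r + 1) with hX
  have hX0 : 0 ≤ X := pow_nonneg (mul_nonneg (hx0 _) (hx0 _)) _
  set v := stackSum y true (2 * (r + 1)) []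
  have hv0 : 0 ≤ v := stackSum_nonneg hy _ _ _
  have hvP : v ≤ P := by
    refine le_trans ?_ hprod
    rw [← altProd_true_two_mul fun t => 1 + r * y t]
    refine stackSum_le hy r true _ [] ?_ ?_ <;> simp <;> omega
  have hT : ∑ w ∈ altWords ty true (2 * (r + 1)), N ^ (w.length - w.toFinset.card) ≤ X * P := by
    refine (sum_altWords_pow_le N hN0 r true _ le_rfl).trans ?_
    rw [altProd_true_two_mul, ← hx, ← hx]
    calc ((x true + r * N) * (x false + r * N)) ^ (r + 1)
        = X * ((1 + r * y true) * (1 + r * y false)) ^ (r + 1) := by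
          rw [hX, ← mul_pow]; congr 1
          linear_combination (-(r * (x false + r * N))) * hxy true -
            (r * (x true + r * x true * y true)) * hxy false
      _ ≤ X * P := mul_le_mul_of_nonneg_left hprod hX0
  set Z := ∑ w ∈ altWords ty true (2 * (r + 1)), stackWeight N [] ∅ w with hZ
  have hZ1 : Z ≤ X * v := by
    have := sum_stackWeight_le hN0 hy hx hxy true (2 * (r + 1)) List.nodup_nil ∅
    rwa [altProd_true_two_mul] at this
  set β := ((r + 1 : ℕ) : ℝ) / μ with hβ
  have hβ0 : 0 ≤ β := by positivity
  have hβ1 : β ≤ 1 := (div_le_one hμ0).2 hlμ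
  have hZ2 : (1 - β) ^ (2 * (r + 1)) * (X * v) ≤ Z := by
    have := le_sum_stackWeight hN0 hy hx hxy (γ := 1 - β) (l := r + 1) (by linarith)
      (by linarith) (fun t => ?_) true (2 * (r + 1)) List.nodup_nil (D := ∅) (by simp)
      (by simp; omega) (by simp)
    · rwa [altProd_true_two_mul] at this
    · have h1 : β * μ = ((r + 1 : ℕ) : ℝ) := div_mul_cancel₀ _ hμ0.ne'
      nlinarith [hμ t]
  -- Bernoulli's inequality, with β = l / μ bounding the fraction of letters used up.
  have hbern : 1 - 2 * ((r + 1 : ℕ) : ℝ) * β ≤ (1 - β) ^ (2 * (r + 1)) := by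
    have := one_add_mul_le_pow (a := -β) (by linarith) (2 * (r + 1))
    push_cast at this ⊢
    rw [← sub_eq_add_neg] at this
    linarith
  have hXv : 0 ≤ X * v := mul_nonneg hX0 hv0
  have habs : |Z - X * v| ≤ 2 * ((r + 1 : ℕ) : ℝ) * β * (X * P) := by
    have h1 : 0 ≤ 2 * ((r + 1 : ℕ) : ℝ) * β := by positivity
    have h2 := mul_le_mul_of_nonneg_left (mul_le_mul_of_nonneg_left hvP hX0) h1
    rw [abs_le]
    constructor
    · nlinarith [mul_le_mul_of_nonneg_right hbern hXv]
    · have := mul_nonneg h1 hXv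
      linarith
  have hsplit : ∑ w ∈ altWords ty true (2 * (r + 1)), wordTrace e χ w -
        ((N * (X * v) : ℝ) : ℂ) =
      ∑ w ∈ altWords ty true (2 * (r + 1)),
        (wordTrace e χ w - Fintype.card ι * (stackWeight N [] ∅ w : ℂ)) +
        ((N * (Z - X * v) : ℝ) : ℂ) := by
    rw [Finset.sum_sub_distrib, ← Finset.mul_sum, hZ]
    push_cast
    rw [hN]
    push_cast
    ring
  rw [hsplit]
  refine (norm_add_le _ _).trans ?_
  have hA := (norm_sum_le _ _).trans (Finset.sum_le_sum fun w
    (_ : w ∈ altWords ty true (2 * (r + 1))) => h.norm_wordTrace_sub_le w)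
  rw [← Finset.mul_sum] at hA
  rw [Complex.norm_real, Real.norm_eq_abs, abs_mul, abs_of_nonneg hN0]
  have hB := mul_le_mul_of_nonneg_left habs hN0
  linarith

end MeanTrace

/-! ### Gram matrices and characters of codes. -/

section Codes

theorem trace_pow_eq_sum_eigenvalues {N : ℕ} {G : Matrix (Fin N) (Fin N) ℂ} (hG : G.IsHermitian)
    (l : ℕ) : (G ^ l).trace = ((∑ i, hG.eigenvalues i ^ l : ℝ) : ℂ) := by
  conv_lhs => rw [hG.spectral_theorem, ← map_pow, Unitary.conjStarAlgAut_apply,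
    Matrix.trace_mul_cycle, Unitary.coe_star_mul_self, one_mul, Matrix.diagonal_pow,
    Matrix.trace_diagonal]
  push_cast
  rfl

theorem mul_mul_pow_succ {m n : ℕ} (A : Matrix (Fin m) (Fin n) ℂ) (P : Matrix (Fin n) (Fin m) ℂ)
    (k : ℕ) : (A * P) ^ (k + 1) = A * (P * A) ^ k * P := by
  induction k with
  | zero => simp
  | succ k ih => rw [pow_succ, ih, pow_succ]; simp only [Matrix.mul_assoc]

theorem trace_mul_pow_comm {m n : ℕ} (A : Matrix (Fin m) (Fin n) ℂ)
    (P : Matrix (Fin n) (Fin m) ℂ) {l : ℕ} (hl : 1 ≤ l) :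
    ((A * P) ^ l).trace = ((P * A) ^ l).trace := by
  obtain ⟨k, rfl⟩ : ∃ k, l = k + 1 := ⟨l - 1, by omega⟩
  rw [mul_mul_pow_succ, Matrix.trace_mul_comm, ← Matrix.mul_assoc, pow_succ']

theorem gram_normalizedProduct {n Na Nb : ℕ} (A : Matrix (Fin Na) (Fin n) ℂ)
    (B : Matrix (Fin Nb) (Fin n) ℂ) :
    gram (normalizedProduct A B) = ((1 / ((Na : ℝ) * Nb) : ℝ) : ℂ) • (A * (Bᴴ * B * Aᴴ)) := by
  rw [gram, normalizedProduct, Matrix.conjTranspose_smul, Matrix.smul_mul, Matrix.mul_smul,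
    smul_smul]
  congr 1
  · rw [Complex.star_def, Complex.conj_ofReal, ← Complex.ofReal_mul]
    congr 1
    rw [div_mul_div_comm, one_mul, Real.mul_self_sqrt (by positivity)]
  · simp only [Matrix.conjTranspose_mul, Matrix.conjTranspose_conjTranspose, Matrix.mul_assoc]

/-- Cyclicity passes to n × n matrices, where both factors are sums over rows. For l = 0 the two
traces would be those of identities of different sizes. -/
theorem spectralMoment_gram {n Na Nb : ℕ} (A : Matrix (Fin Na) (Fin n) ℂ)
    (B : Matrix (Fin Nb) (Fin n) ℂ) {l : ℕ} (hl : 1 ≤ l) :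
    ((spectralMoment (gram_isHermitian (normalizedProduct A B)) l : ℝ) : ℂ) =
      ((1 / (Na : ℝ) * (1 / ((Na : ℝ) * Nb)) ^ l : ℝ) : ℂ) *
        ((Aᴴ * A * (Bᴴ * B)) ^ l).trace := by
  rw [spectralMoment, Complex.ofReal_mul, ← trace_pow_eq_sum_eigenvalues,
    gram_normalizedProduct, smul_pow, Matrix.trace_smul, trace_mul_pow_comm _ _ hl,
    Matrix.mul_assoc, trace_mul_pow_comm _ _ hl]
  push_cast
  rw [smul_eq_mul, mul_assoc]

variable {p : ℕ} [Fact p.Prime] {F : Type*} [Field F] [Algebra (ZMod p) F]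

variable (p F) in
/-- `stdChar` as an additive character. -/
noncomputable def stdAddCharField : AddChar F ℂ :=
  ZMod.stdAddChar.compAddMonoidHom (Algebra.trace (ZMod p) F).toAddMonoidHom

theorem stdAddCharField_apply (z : F) : stdAddCharField p F z = stdChar p z := by
  change ZMod.stdAddChar (Algebra.trace (ZMod p) F z) = _
  rw [ZMod.stdAddChar_apply, ZMod.toCircle_apply, stdChar]

theorem star_stdAddCharField (z : F) :
    star (stdAddCharField p F z) = stdAddCharField p F (-z) := by
  change star (ZMod.stdAddChar _) = ZMod.stdAddChar ((Algebra.trace (ZMod p) F) (-z))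
  rw [map_neg, AddChar.map_neg_eq_inv, ZMod.stdAddChar_apply]
  change (starRingEnd ℂ) _ = _
  rw [← Circle.coe_inv_eq_conj, Circle.coe_inv]
  rfl

variable {n : ℕ}

variable (p) in
/-- The character `v ↦ ψ(c ⬝ v)`. -/
noncomputable def codeChar (c : Fin n → F) : AddChar (Fin n → F) ℂ :=
  (stdAddCharField p F).compAddMonoidHom
    { toFun := fun v => c ⬝ᵥ v, map_zero' := dotProduct_zero c, map_add' := dotProduct_add c }

theorem codeChar_apply (c v : Fin n → F) : codeChar p c v = stdAddCharField p F (c ⬝ᵥ v) := rfl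

variable (p) in
/-- The character `c ↦ ψ(c ⬝ v)` of a code. -/
noncomputable def wordChar (C : Submodule F (Fin n → F)) (v : Fin n → F) : AddChar C ℂ :=
  (stdAddCharField p F).compAddMonoidHom
    { toFun := fun c => (c : Fin n → F) ⬝ᵥ v, map_zero' := zero_dotProduct v,
      map_add' := fun c d => add_dotProduct (c : Fin n → F) d v }

theorem sum_codeChar_of_mem {C : Submodule F (Fin n → F)} [Fintype C] {v : Fin n → F}
    (hv : v ∈ dualCode C) : ∑ c : C, codeChar p (c : Fin n → F) v = Fintype.card C := by
  have : ∀ c : C, codeChar p (c : Fin n → F) v = 1 := fun c => by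
    rw [codeChar_apply, hv c c.2, AddChar.map_zero_eq_one]
  simp [this]

/-- If the character of the code were trivial, linearity of C would give Tr(b (c ⬝ v)) = 0 for all
b, against the nondegeneracy of the trace form. -/
theorem sum_codeChar_of_notMem [Finite F] {C : Submodule F (Fin n → F)} [Fintype C]
    {v : Fin n → F} (hv : v ∉ dualCode C) : ∑ c : C, codeChar p (c : Fin n → F) v = 0 := by
  change ∑ c : C, wordChar p C v c = 0
  rw [AddChar.sum_eq_zero_iff_ne_zero]
  intro h0
  obtain ⟨c, hc, hcv⟩ : ∃ c ∈ C, c ⬝ᵥ v ≠ 0 := by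
    by_contra! hcon
    exact hv hcon
  apply hcv
  have := Fintype.ofFinite F
  apply (traceForm_nondegenerate (ZMod p) F).1
  intro b
  rw [Algebra.traceForm_apply]
  have h1 := DFunLike.congr_fun h0 (b • ⟨c, hc⟩ : C)
  change ZMod.stdAddChar (Algebra.trace (ZMod p) F ((b • c) ⬝ᵥ v)) = 1 at h1
  rw [← AddChar.map_zero_eq_one (ZMod.stdAddChar (N := p))] at h1
  have h2 := ZMod.injective_stdAddChar h1
  rwa [smul_dotProduct, smul_eq_mul, mul_comm] at h2

theorem eq_zero_of_mem_dualCode {C : Submodule F (Fin n → F)} (hd : 5 ≤ dualDistance C)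
    {v : Fin n → F} (hv : v ∈ dualCode C) (s : Finset (Fin n)) (hs : s.card ≤ 4)
    (hvs : ∀ t, v t ≠ 0 → t ∈ s) : v = 0 := by
  classical
  by_contra hne
  rw [dualDistance, minDistance] at hd
  have h1 := le_iInf_iff.1 (le_iInf_iff.1 hd v) ⟨hv, hne⟩
  have h2 : 5 ≤ (Finset.univ.filter fun t => v t ≠ 0).card := by
    unfold hammingNorm at h1
    convert Nat.cast_le (α := ℕ∞) |>.1 h1
  have h3 : (Finset.univ.filter fun t => v t ≠ 0).card ≤ s.card :=
    Finset.card_le_card fun t ht => hvs t (Finset.mem_filter.1 ht).2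
  omega

/-- The vectors in question have weight at most 4, so they lie in a dual code only when they vanish.
-/
theorem isFourWise_codeChar [Finite F] {K : Type*} (C : K → Submodule F (Fin n → F))
    [∀ k, Fintype (C k)] (hd : ∀ k, 5 ≤ dualDistance (C k)) :
    IsFourWise (fun t => (Pi.single t 1 : Fin n → F))
      (fun k (c : C k) => codeChar p (c : Fin n → F)) (fun k => (dualCode (C k)).toAddSubgroup) where
  mean k v hv := sum_codeChar_of_mem hv
  mean_zero k v hv := sum_codeChar_of_notMem hv
  eq_of_sub_mem k s t hst := by
    have h0 := eq_zero_of_mem_dualCode (hd k) hst {s, t} (Finset.card_le_two.trans (by norm_num))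
      (fun r hr => by
        by_contra hcon
        simp only [Finset.mem_insert, Finset.mem_singleton, not_or] at hcon
        exact hr (by simp [hcon.1, hcon.2]))
    by_contra hne
    have := congrFun h0 s
    simp [hne] at this
  eq_or_eq_of_sub_mem k s t s' t' hst hst' hmem := by
    have h0 := eq_zero_of_mem_dualCode (hd k) hmem {s, t, s', t'} Finset.card_le_four
      (fun r hr => by
        by_contra hcon
        simp only [Finset.mem_insert, Finset.mem_singleton, not_or] at hcon
        exact hr (by simp [hcon.1, hcon.2.1, hcon.2.2.1, hcon.2.2.2]))
    by_contra! hne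
    have := congrFun h0 t'
    simp [hne.1, hne.2, hst'.symm] at this

theorem sum_stepMatrix_codeChar {N : ℕ} (c : Fin N → Fin n → F) :
    ∑ i, stepMatrix (fun t => (Pi.single t 1 : Fin n → F)) (codeChar p (c i)) =
      (Matrix.of fun i t => stdChar p (c i t))ᴴ * Matrix.of fun i t => stdChar p (c i t) := by
  ext t s
  rw [Matrix.sum_apply, Matrix.mul_apply]
  refine Finset.sum_congr rfl fun i _ => ?_
  rw [Matrix.conjTranspose_apply, Matrix.of_apply, Matrix.of_apply, ← stdAddCharField_apply,
    ← stdAddCharField_apply, star_stdAddCharField, ← AddChar.map_add_eq_mul, stepMatrix,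
    Matrix.of_apply, codeChar_apply, dotProduct_sub, dotProduct_single_one, dotProduct_single_one]
  congr 1; ring

/-- The map `ε` need not be injective, but its fibres on a code are cosets of equal size, so a
uniform signal is the image of a uniform codeword. -/
theorem average_comp {G S : Type*} [AddCommGroup G] [Fintype G] [Fintype S] (φ : G → S)
    (hφ : Function.Surjective φ) (hker : ∀ a b, φ a = φ b ↔ φ (a - b) = φ 0) (f : S → ℝ) :
    (∑ s, f s) / Fintype.card S = (∑ g, f (φ g)) / Fintype.card G := by
  classical
  set M := (Finset.univ.filter fun g => φ g = φ 0).card with hM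
  have hfib : ∀ s, (Finset.univ.filter fun g => φ g = s).card = M := by
    intro s
    obtain ⟨a, rfl⟩ := hφ s
    refine Finset.card_nbij' (fun g => g - a) (fun g => g + a) ?_ ?_ ?_ ?_
    · intro g hg; simpa [hker g a] using hg
    · intro g hg; simpa [hker (g + a) a] using hg
    · intro g _; simp
    · intro g _; simp
  have hsum : ∀ f : S → ℝ, ∑ g, f (φ g) = M * ∑ s, f s := by
    intro f
    rw [← Finset.sum_fiberwise (g := φ), Finset.mul_sum]
    refine Finset.sum_congr rfl fun s _ => ?_
    rw [Finset.sum_congr rfl (g := fun _ => f s)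
      (fun g hg => by rw [(Finset.mem_filter.1 hg).2]), Finset.sum_const, hfib, nsmul_eq_mul]
  have hcard := hsum fun _ => 1
  have hM0 : (M : ℝ) ≠ 0 := by
    have h0 : (0 : G) ∈ Finset.univ.filter fun g => φ g = φ 0 := by
      rw [Finset.mem_filter]; exact ⟨Finset.mem_univ _, rfl⟩
    exact Nat.cast_ne_zero.2 (Finset.card_pos.2 ⟨0, h0⟩).ne'
  simp only [Finset.sum_const, Finset.card_univ, nsmul_eq_mul, mul_one] at hcard
  rw [hsum, hcard, mul_div_mul_left _ _ hM0]

end Codes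

/-! ### From random signals to random codewords. -/

section Signals

variable {p : ℕ} [Fact p.Prime] {F : Type*} [Field F] [Fintype F] [Algebra (ZMod p) F] {n : ℕ}

variable (p) in
/-- The vector `ε(c)` of a codeword. -/
noncomputable def toSignal (C : Submodule F (Fin n → F)) (c : C) : signalSet p C :=
  ⟨fun t => stdChar p ((c : Fin n → F) t), by
    classical
    exact Finset.mem_image.2 ⟨c, Finset.mem_filter.2 ⟨Finset.mem_univ _, c.2⟩, rfl⟩⟩

theorem toSignal_surjective (C : Submodule F (Fin n → F)) :
    Function.Surjective (toSignal p C) := by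
  classical
  rintro ⟨x, hx⟩
  obtain ⟨c, hc, rfl⟩ := Finset.mem_image.1 hx
  exact ⟨⟨c, (Finset.mem_filter.1 hc).2⟩, rfl⟩

theorem toSignal_eq_iff (C : Submodule F (Fin n → F)) (a b : C) :
    toSignal p C a = toSignal p C b ↔ toSignal p C (a - b) = toSignal p C 0 := by
  have h : ∀ x y : F, stdChar p x = stdChar p y ↔ stdChar p (x - y) = stdChar p (0 : F) := by
    intro x y
    simp only [← stdAddCharField_apply]
    rw [AddChar.map_sub_eq_div, AddChar.map_zero_eq_one, div_eq_one_iff_eq]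
    exact (AddChar.val_isUnit _ y).ne_zero
  rw [Subtype.ext_iff, Subtype.ext_iff, funext_iff, funext_iff]
  exact forall_congr' fun t => h _ _

/-- The code of each row of the two matrices. -/
def rowCode {F : Type*} [Field F] {n : ℕ} (Ca Cb : Submodule F (Fin n → F)) {Na Nb : ℕ}
    (k : Fin Na ⊕ Fin Nb) : Submodule F (Fin n → F) :=
  Sum.elim (fun _ => Ca) (fun _ => Cb) k

/-- The two families of rows of a family of codewords. -/
noncomputable def toSignals (p : ℕ) [Fact p.Prime] {F : Type*} [Field F] [Fintype F]
    [Algebra (ZMod p) F] {n : ℕ} (Ca Cb : Submodule F (Fin n → F)) {Na Nb : ℕ}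
    (g : ∀ k : Fin Na ⊕ Fin Nb, rowCode Ca Cb k) :
    (Fin Na → signalSet p Ca) × (Fin Nb → signalSet p Cb) :=
  (fun i => toSignal p Ca (g (Sum.inl i)), fun j => toSignal p Cb (g (Sum.inr j)))

theorem toSignals_surjective (Ca Cb : Submodule F (Fin n → F)) {Na Nb : ℕ} :
    Function.Surjective (toSignals p Ca Cb (Na := Na) (Nb := Nb)) := by
  rintro ⟨s, s'⟩
  choose a ha using fun i => toSignal_surjective Ca (s i)
  choose b hb using fun i => toSignal_surjective Cb (s' i)
  refine ⟨fun k => match k with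
    | Sum.inl i => a i
    | Sum.inr j => b j, ?_⟩
  exact Prod.ext (funext ha) (funext hb)

theorem toSignals_eq_iff (Ca Cb : Submodule F (Fin n → F)) {Na Nb : ℕ}
    (g g' : ∀ k : Fin Na ⊕ Fin Nb, rowCode Ca Cb k) :
    toSignals p Ca Cb g = toSignals p Ca Cb g' ↔
      toSignals p Ca Cb (g - g') = toSignals p Ca Cb 0 := by
  simp only [toSignals, Prod.mk.injEq, funext_iff]
  exact and_congr (forall_congr' fun i => toSignal_eq_iff Ca _ _)
    (forall_congr' fun j => toSignal_eq_iff Cb _ _)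

theorem sum_filter_isLeft {Na Nb : ℕ} {R : Type*} [AddCommMonoid R]
    (D : Fin Na ⊕ Fin Nb → R) :
    ∑ k with Sum.isLeft k = true, D k = ∑ i, D (Sum.inl i) := by
  rw [Finset.sum_filter, Fintype.sum_sum_type]; simp

theorem sum_filter_not_isLeft {Na Nb : ℕ} {R : Type*} [AddCommMonoid R]
    (D : Fin Na ⊕ Fin Nb → R) :
    ∑ k with Sum.isLeft k = false, D k = ∑ j, D (Sum.inr j) := by
  rw [Finset.sum_filter, Fintype.sum_sum_type]; simp

/-- The expected moment as a sum of mean traces over the alternating words. -/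
theorem expectedMoment_eq_sum (Ca Cb : Submodule F (Fin n → F)) (Na Nb : ℕ) {l : ℕ} (hl : 1 ≤ l)
    [∀ k : Fin Na ⊕ Fin Nb, Fintype (rowCode Ca Cb k)] :
    ((expectedMoment p Ca Cb Na Nb l : ℝ) : ℂ) =
      ((1 / (Na : ℝ) * (1 / ((Na : ℝ) * Nb)) ^ l : ℝ) : ℂ) *
        ∑ w ∈ altWords Sum.isLeft true (2 * l),
          wordTrace (fun t => (Pi.single t 1 : Fin n → F))
            (fun (k : Fin Na ⊕ Fin Nb) (c : rowCode Ca Cb k) =>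
              codeChar p (c : Fin n → F)) w := by
  rw [expectedMoment, average_comp (toSignals p Ca Cb) (toSignals_surjective Ca Cb)
    (toSignals_eq_iff Ca Cb)]
  simp only [wordTrace]
  rw [← Finset.sum_div, Finset.sum_comm, Complex.ofReal_div, Complex.ofReal_sum, mul_div_assoc',
    Finset.mul_sum]
  congr 1
  refine Finset.sum_congr rfl fun g _ => ?_
  rw [spectralMoment_gram _ _ hl, ← Matrix.trace_sum, sum_altWords_prod, sum_filter_isLeft,
    sum_filter_not_isLeft, sum_stepMatrix_codeChar fun i => (g (Sum.inl i) : Fin n → F),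
    sum_stepMatrix_codeChar fun j => (g (Sum.inr j) : Fin n → F)]
  rfl

end Signals

/-! ### Final estimate. -/

theorem error_factor_le {l : ℕ} (hl : 2 ≤ l) :
    (3 + 2 * (l : ℝ) ^ 2) * (l : ℝ) ^ (2 * l) ≤ (l : ℝ) ^ (6 * l) := by
  have hl' : (2 : ℝ) ≤ l := by exact_mod_cast hl
  -- This needs l ≥ 2; it fails for l = 1.
  have h1 : (3 + 2 * (l : ℝ) ^ 2) ≤ (l : ℝ) ^ 4 := by nlinarith [sq_nonneg ((l : ℝ) ^ 2 - 4)]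
  have h2 : (l : ℝ) ^ 4 ≤ (l : ℝ) ^ (4 * l) := pow_le_pow_right₀ (by linarith) (by omega)
  calc _ ≤ (l : ℝ) ^ (4 * l) * (l : ℝ) ^ (2 * l) :=
        mul_le_mul_of_nonneg_right (h1.trans h2) (by positivity)
    _ = _ := by rw [← pow_add]; congr 1; omega

theorem theorem2 (p : ℕ) [Fact p.Prime] {F : Type*} [Field F] [Fintype F] [Algebra (ZMod p) F]
    (n : ℕ) (Ca Cb : Submodule F (Fin n → F))
    (hd : 5 ≤ min (dualDistance Ca) (dualDistance Cb))
    (Na Nb : ℕ) (ya yb Ya Yb : ℝ)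
    (hya : ya = (n : ℝ) / (Na : ℝ)) (hyb : yb = (n : ℝ) / (Nb : ℝ))
    (hYa : Ya = max 1 ya) (hYb : Yb = max 1 yb)
    (l : ℕ) (hl : 2 ≤ l) (hlN : (l : ℝ) < min (Real.sqrt (Na : ℝ)) (Real.sqrt (Nb : ℝ))) :
    |expectedMoment p Ca Cb Na Nb l - mainTerm l ya yb| ≤
      (l : ℝ) ^ (6 * l) * Ya * (Ya * Yb) ^ l / min (Na : ℝ) (Nb : ℝ) := by
  have hl1 : (2 : ℝ) ≤ l := by exact_mod_cast hl
  have hle : ∀ N : ℕ, (l : ℝ) < Real.sqrt N → (l : ℝ) ≤ N := by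
    intro N h
    have h1 := (Real.lt_sqrt (by linarith)).1 h
    nlinarith
  have hNa := hle Na (hlN.trans_le (min_le_left _ _))
  have hNb := hle Nb (hlN.trans_le (min_le_right _ _))
  have hNa0 : (0 : ℝ) < Na := by linarith
  have hNb0 : (0 : ℝ) < Nb := by linarith
  set μ := min (Na : ℝ) (Nb : ℝ) with hμ
  have hlμ : (l : ℝ) ≤ μ := le_min hNa hNb
  have hμ0 : 0 < μ := by linarith
  classical
  have (k : Fin Na ⊕ Fin Nb) : Fintype (rowCode Ca Cb k) :=
    Fintype.ofFinite _
  have hd' : ∀ k : Fin Na ⊕ Fin Nb,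
      5 ≤ dualDistance (rowCode Ca Cb k) := by
    rintro (i | j)
    · exact hd.trans (min_le_left _ _)
    · exact hd.trans (min_le_right _ _)
  have hya0 : 0 ≤ ya := by rw [hya]; positivity
  have hyb0 : 0 ≤ yb := by rw [hyb]; positivity
  have hYa1 : 1 ≤ Ya := hYa ▸ le_max_left _ _
  have hYb1 : 1 ≤ Yb := hYb ▸ le_max_left _ _
  have hyYa : ya ≤ Ya := hYa ▸ le_max_right _ _
  have hyYb : yb ≤ Yb := hYb ▸ le_max_right _ _
  -- Type `true` labels the rows of A, type `false` those of B.
  have hmain := (isFourWise_codeChar (p := p) _ hd').norm_sum_wordTrace_sub_le Sum.isLeft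
    (x := fun t => if t then (Na : ℝ) else Nb) (y := fun t => if t then ya else yb)
    (Y := fun t => if t then Ya else Yb) (by rintro (_ | _) <;> simp [hya0, hyb0])
    (by
      rintro (_ | _)
      · rw [Finset.card_eq_sum_ones, sum_filter_not_isLeft]; simp
      · rw [Finset.card_eq_sum_ones, sum_filter_isLeft]; simp)
    (by
      rintro (_ | _)
      · simp [hyb]; field_simp
      · simp [hya]; field_simp)
    (by rintro (_ | _) <;> simp [hYa1, hYb1]) (by rintro (_ | _) <;> simp [hyYa, hyYb])
    (l := l) (by omega) (μ := μ) (by rintro (_ | _) <;> simp [hμ]) hlμ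
  have hterm := mainTerm_eq_coeff (l := l) (by omega) (fun t => if t then ya else yb)
  simp only [if_true, Bool.false_eq_true, if_false, Fintype.card_fin] at hmain hterm
  set c : ℝ := 1 / (Na : ℝ) * (1 / ((Na : ℝ) * Nb)) ^ l with hc
  have hc0 : 0 ≤ c := by positivity
  have hcX : c * ((Na : ℝ) * Nb) ^ l = 1 / Na := by
    rw [hc, mul_assoc, ← mul_pow, one_div_mul_cancel (by positivity), one_pow, mul_one]
  set v := stackSum (fun t => if t then ya else yb) true (2 * l) []
  have hcv : mainTerm l ya yb = c * (n * (((Na : ℝ) * Nb) ^ l * v)) := by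
    rw [hterm, hya]
    linear_combination (-(n * v)) * hcX
  have hE := expectedMoment_eq_sum (p := p) Ca Cb Na Nb (l := l) (by omega)
  have h1 : |expectedMoment p Ca Cb Na Nb l - mainTerm l ya yb| ≤
      c * ((3 + 2 * l * (l / μ) * n) * (((Na : ℝ) * Nb) ^ l * ((l * Ya) * (l * Yb)) ^ l)) := by
    rw [← Real.norm_eq_abs, ← Complex.norm_real, Complex.ofReal_sub, hE, hcv,
      Complex.ofReal_mul c, ← mul_sub, norm_mul, Complex.norm_real, Real.norm_eq_abs,
      abs_of_nonneg hc0]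
    exact mul_le_mul_of_nonneg_left hmain hc0
  refine h1.trans ?_
  set P := (Ya * Yb) ^ l with hP
  have hP0 : 0 ≤ P := by positivity
  have h2 : ((l * Ya) * (l * Yb)) ^ l = (l : ℝ) ^ (2 * l) * P := by
    rw [hP, pow_mul, ← mul_pow]; congr 1; ring
  -- The factor n is absorbed by n / N_a = y_a, the source of the extra factor Y_a in the bound.
  have h3 : (3 + 2 * l * (l / μ) * n) / Na ≤ (3 + 2 * (l : ℝ) ^ 2) * Ya / μ := by
    have e1 : (3 : ℝ) / Na ≤ 3 * Ya / μ := by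
      gcongr
      · linarith
      · exact min_le_left _ _
    have e2 : 2 * l * (l / μ) * n / Na = 2 * (l : ℝ) ^ 2 * ya / μ := by rw [hya]; ring
    have e3 : 2 * (l : ℝ) ^ 2 * ya / μ ≤ 2 * (l : ℝ) ^ 2 * Ya / μ := by gcongr
    rw [add_div, e2]
    calc _ ≤ 3 * Ya / μ + 2 * (l : ℝ) ^ 2 * Ya / μ := add_le_add e1 e3
      _ = _ := by ring
  have h4 := error_factor_le hl
  calc c * ((3 + 2 * l * (l / μ) * n) * (((Na : ℝ) * Nb) ^ l * ((l * Ya) * (l * Yb)) ^ l))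
      = (3 + 2 * l * (l / μ) * n) / Na * ((l : ℝ) ^ (2 * l) * P) := by
        rw [h2]; linear_combination ((3 + 2 * l * (l / μ) * n) * ((l : ℝ) ^ (2 * l) * P)) * hcX
    _ ≤ (3 + 2 * (l : ℝ) ^ 2) * Ya / μ * ((l : ℝ) ^ (2 * l) * P) :=
        mul_le_mul_of_nonneg_right h3 (by positivity)
    _ = (3 + 2 * (l : ℝ) ^ 2) * (l : ℝ) ^ (2 * l) * (Ya * P / μ) := by ring
    _ ≤ (l : ℝ) ^ (6 * l) * (Ya * P / μ) := mul_le_mul_of_nonneg_right h4 (by positivity)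
    _ = _ := by ring
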